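/- An election consists of $m\ge 1$ candidates and an ordered list $(v_1,\dots,v_n)$ of $n\ge 1$ voters, each with a linear order over the candidates; $\mathrm{pos}_v(c)\in[m]$ is the position of $c$ in the order of $v$ (position $1$ is the best). It is single-crossing if for all candidates $a,b$ such that $v_1$ prefers $a$ to $b$ there is $t\in[n]$ such that the voters who prefer $a$ to $b$ are exactly $v_1,\dots,v_t$. A dissatisfaction function for $m$ candidates is a nondecreasing $\alpha^m\colon[m]\to\mathbb N$ with $\alpha^m(1)=0$; a family $\alpha=(\alpha^m)_{m\ge1}$ is polynomial-time computable if $\alpha^m(i)$ can be computed from $m$ and $i$ in time polynomial in $m$. For a positive integer $k$, a $k$-CC assignment is a map $\Phi$ from the voters to the candidates with at most $k$ values. It is optimal under $\alpha$-$\ell$-CC if it minimizes $\ell(\Phi)$ among all $k$-CC assignments, where $\ell_1(\Phi)=\sum_{i=1}^n\alpha^m(\mathrm{pos}_{v_i}(\Phi(v_i)))$ and $\ell_\infty(\Phi)=\max_{1\le i\le n}\alpha^m(\mathrm{pos}_{v_i}(\Phi(v_i)))$. Theorem. Let $\ell\in\{\ell_1,\ell_\infty\}$. For every polynomial-time computable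 family $\alpha$ of dissatisfaction functions there is an algorithm that, given a single-crossing election and a positive integer $k$, finds an optimal $k$-CC assignment under $\alpha$-$\ell$-CC in time polynomial in the length of the input. Apart from a time polynomial in $m$ for evaluating $\alpha^m$, it takes $O(mn^2k)$ steps on a unit-cost random access machine (whose arithmetic consists of addition and subtraction). If the $m$ values of an arbitrary dissatisfaction function $\alpha^m$ are given as part of the input, then such an assignment can be found in $O(mn^2k)$ steps, by one algorithm that does not depend on $\alpha^m$ and with an absolute constant. -/

import Mathlib

namespace SCElection

/-! ### Random access machines with unit cost

A machine has registers `reg 0, reg 1, …` and arrays `arr 0, arr 1, …` of natural numbers; a program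
mentions finitely many of them. The only arithmetic is addition and (truncated) subtraction, so
that numbers grow by at most one bit per step and unit-cost time is polynomially related to
Turing machine time. -/

/-- The memory of a machine. -/
structure Mem where
  reg : ℕ → ℕ
  arr : ℕ → ℕ → ℕ

/-- Write the value `v` into register `x`. -/
def Mem.setReg (s : Mem) (x v : ℕ) : Mem :=
  { s with reg := Function.update s.reg x v }

/-- Write the value `v` into cell `i` of array `a`. -/
def Mem.setArr (s : Mem) (a i v : ℕ) : Mem :=
  { s with arr := Function.update s.arr a (Function.update (s.arr a) i v) }

/-- Programs: assignments, array access through registers, tests `reg x < reg y`, loops. -/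
inductive Program : Type
  /-- do nothing -/
  | skip : Program
  /-- `reg x := c` -/
  | const (x c : ℕ) : Program
  /-- `reg x := reg y + reg z` -/
  | add (x y z : ℕ) : Program
  /-- `reg x := reg y - reg z` (zero if negative) -/
  | sub (x y z : ℕ) : Program
  /-- `reg x := arr a [reg y]` -/
  | load (x a y : ℕ) : Program
  /-- `arr a [reg x] := reg y` -/
  | store (a x y : ℕ) : Program
  /-- first `P`, then `Q` -/
  | seq (P Q : Program) : Program
  /-- if `reg x < reg y` then `P` else `Q` -/
  | ifLT (x y : ℕ) (P Q : Program) : Program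
  /-- while `reg x < reg y` do `P` -/
  | whileLT (x y : ℕ) (P : Program) : Program

/-- `Exec P s s' t`: started in memory `s`, the program `P` halts in memory `s'` after exactly `t`
steps. Every elementary instruction and every evaluation of a test is one step. -/
inductive Exec : Program → Mem → Mem → ℕ → Prop
  | skip (s : Mem) : Exec .skip s s 1
  | const (s : Mem) (x c : ℕ) : Exec (.const x c) s (s.setReg x c) 1
  | add (s : Mem) (x y z : ℕ) : Exec (.add x y z) s (s.setReg x (s.reg y + s.reg z)) 1
  | sub (s : Mem) (x y z : ℕ) : Exec (.sub x y z) s (s.setReg x (s.reg y - s.reg z)) 1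
  | load (s : Mem) (x a y : ℕ) : Exec (.load x a y) s (s.setReg x (s.arr a (s.reg y))) 1
  | store (s : Mem) (a x y : ℕ) : Exec (.store a x y) s (s.setArr a (s.reg x) (s.reg y)) 1
  | seq {P Q : Program} {s s' s'' : Mem} {t u : ℕ} (hP : Exec P s s' t) (hQ : Exec Q s' s'' u) :
      Exec (.seq P Q) s s'' (t + u)
  | ifTrue {x y : ℕ} {P Q : Program} {s s' : Mem} {t : ℕ} (h : s.reg x < s.reg y)
      (hP : Exec P s s' t) : Exec (.ifLT x y P Q) s s' (t + 1)
  | ifFalse {x y : ℕ} {P Q : Program} {s s' : Mem} {t : ℕ} (h : ¬ s.reg x < s.reg y)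
      (hQ : Exec Q s s' t) : Exec (.ifLT x y P Q) s s' (t + 1)
  | whileTrue {x y : ℕ} {P : Program} {s s' s'' : Mem} {t u : ℕ} (h : s.reg x < s.reg y)
      (hP : Exec P s s' t) (hW : Exec (.whileLT x y P) s' s'' u) :
      Exec (.whileLT x y P) s s'' (t + u + 1)
  | whileFalse {x y : ℕ} {P : Program} {s : Mem} (h : ¬ s.reg x < s.reg y) :
      Exec (.whileLT x y P) s s 1

/-- The initial memory: the input words are in array `0`, their number is in register `0`, and
everything else is zero. -/
def Mem.init (input : List ℕ) : Mem where
  reg x := if x = 0 then input.length else 0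
  arr a i := if a = 0 then input.getD i 0 else 0

/-- The output: register `1` holds its length, array `1` its words. -/
def Mem.output (s : Mem) : List ℕ :=
  (List.range (s.reg 1)).map (s.arr 1)

/-- On the given input, `P` halts after exactly `t` steps with the given output. -/
def Program.Outputs (P : Program) (input output : List ℕ) (t : ℕ) : Prop :=
  ∃ s : Mem, Exec P (Mem.init input) s t ∧ s.output = output

/-- The length of an input in bits (each word in binary, followed by a separator). -/
def bitLength (input : List ℕ) : ℕ :=
  (input.map fun w => w.size + 1).sum

/-! ### Elections -/

/-- An election with candidates `0, …, m - 1` and the ordered list of voters `0, …, n - 1`;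
`vote i r` is the candidate that voter `i` ranks in position `r`, where positions are numbered
from `0` (the most preferred candidate) to `m - 1`. -/
structure Election where
  m : ℕ
  n : ℕ
  m_pos : 0 < m
  n_pos : 0 < n
  vote : Fin n → Equiv.Perm (Fin m)

/-- The position of candidate `c` in the preference order of voter `i`, counted from `0`. -/
def Election.pos (E : Election) (i : Fin E.n) (c : Fin E.m) : Fin E.m :=
  (E.vote i).symm c

/-- Voter `i` prefers candidate `a` to candidate `b`. -/
def Election.Prefers (E : Election) (i : Fin E.n) (a b : Fin E.m) : Prop :=
  E.pos i a < E.pos i b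

/-- The election is single-crossing with respect to the given order of the voters: for all
candidates `a`, `b` such that the first voter prefers `a` to `b`, the voters who prefer `a` to `b`
are exactly the first `t` voters, for some `1 ≤ t ≤ n`. -/
def Election.SingleCrossing (E : Election) : Prop :=
  ∀ a b : Fin E.m, E.Prefers ⟨0, E.n_pos⟩ a b →
    ∃ t : ℕ, 1 ≤ t ∧ t ≤ E.n ∧ ∀ i : Fin E.n, E.Prefers i a b ↔ (i : ℕ) < t

/-- Dissatisfaction functions for `m` candidates: nondecreasing, and `0` at the top position. -/
def IsDissatisfaction {m : ℕ} (α : Fin m → ℕ) : Prop :=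
  Monotone α ∧ ∀ i : Fin m, (i : ℕ) = 0 → α i = 0

/-- A family of functions `α m` of the position is polynomial-time computable if one program
computes `α m i` from `m` and `i`, in time polynomial in `m`. -/
def PolyTimeFamily (α : (m : ℕ) → Fin m → ℕ) : Prop :=
  ∃ (P : Program) (p : Polynomial ℕ), ∀ (m : ℕ) (i : Fin m),
    ∃ t ≤ p.eval m, P.Outputs [m, i] [α m i] t

/-- The two ways of aggregating the dissatisfactions of the voters. -/
inductive Aggregation : Type
  /-- the sum -/
  | l1 : Aggregation
  /-- the maximum -/
  | linf : Aggregation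

/-- Aggregation of a vector of natural numbers. -/
def Aggregation.eval : Aggregation → {n : ℕ} → (Fin n → ℕ) → ℕ
  | .l1, _, f => ∑ i, f i
  | .linf, _, f => Finset.univ.sup f

/-- `k`-CC-assignments: assignments of candidates to voters with at most `k` values. -/
def Election.IsCCAssignment (E : Election) (k : ℕ) (Φ : Fin E.n → Fin E.m) : Prop :=
  (Finset.univ.image Φ).card ≤ k

/-- The aggregated dissatisfaction `ℓ(Φ)` of an assignment. -/
def Election.dissatisfaction (E : Election) (α : Fin E.m → ℕ) (ℓ : Aggregation)
    (Φ : Fin E.n → Fin E.m) : ℕ :=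
  ℓ.eval fun i => α (E.pos i (Φ i))

/-- Optimal `k`-CC-assignments under `α`-`ℓ`-CC. -/
def Election.IsOptimalCC (E : Election) (α : Fin E.m → ℕ) (ℓ : Aggregation) (k : ℕ)
    (Φ : Fin E.n → Fin E.m) : Prop :=
  E.IsCCAssignment k Φ ∧
    ∀ Ψ : Fin E.n → Fin E.m, E.IsCCAssignment k Ψ →
      E.dissatisfaction α ℓ Φ ≤ E.dissatisfaction α ℓ Ψ

/-! ### Encodings as lists of words -/

/-- The preference orders, voter by voter, each listed from the best to the worst candidate. -/
def Election.encodeVotes (E : Election) : List ℕ :=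
  (List.ofFn fun i => List.ofFn fun r => (E.vote i r : ℕ)).flatten

/-- The input consisting of an election and `k`. -/
def Election.encode (E : Election) (k : ℕ) : List ℕ :=
  [E.m, E.n, k] ++ E.encodeVotes

/-- The input consisting of an election, `k`, and the values of a dissatisfaction function. -/
def Election.encodeWith (E : Election) (α : Fin E.m → ℕ) (k : ℕ) : List ℕ :=
  [E.m, E.n, k] ++ List.ofFn α ++ E.encodeVotes

/-- An assignment as the list of the candidates assigned to the voters. -/
def encodeAssignment {n m : ℕ} (Φ : Fin n → Fin m) : List ℕ :=
  List.ofFn fun i => (Φ i : ℕ)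

end SCElection

/-! Fix a committee and give every voter the favourite within it. In a single-crossing election
these favourites move weakly down the order of the first voter as one goes through the voters
(`favourite_mono`). A candidate that has been left therefore never returns, and the sequence of
favourites has fewer changes than values (`changes_lt_card_image`). Conversely, a sequence with at
most t changes has at most t + 1 values. Passing from an assignment to the favourites within its
image does not raise the dissatisfaction, so it suffices to minimize over sequences of candidates
with at most min k n - 1 changes.

This is a shortest path problem on states (t, c), with t changes available and current candidate c.
A state is reached from itself or from the best state of layer t - 1. That best state is the same
for all c, so one state costs constant time and the whole table costs O(m n min(k, n)), which is
within O(m n² k). Both aggregations proceed voter by voter with an operation monotone in the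
accumulated value, so one argument serves both. The table bounds every competitor from below
(`dpTable_le_accum`); following predecessors attains its value (`accum_dpTrace`) with few enough
candidates (`card_image_dpTrace_le`). Capping k by n also keeps the time polynomial when k, written
in binary, is huge.

On the machine, the tables are flat arrays filled in increasing order of address, so that additions
and subtractions suffice to move around in them. Correctness and time are proved together by loop
invariants (`Program.Runs`). If the family is only given by a program P, the m values are first
tabulated by running P on a relocated part of the memory. Used arrays are not wiped: each run starts
beyond all addresses written before, where the memory is still zero (`exec_relocate`,
`runs_tabulate`). -/

namespace SCElection

/-! ### Aggregation, voter by voter -/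

/-- The binary operation behind an aggregation. -/
def Aggregation.op : Aggregation → ℕ → ℕ → ℕ
  | .l1, a, b => a + b
  | .linf, a, b => max a b

/-- Monotonicity in the accumulated value is what makes it safe to keep only the best predecessor of
a state. -/
theorem Aggregation.op_mono (ℓ : Aggregation) {a a' : ℕ} (h : a ≤ a') (b : ℕ) :
    ℓ.op a b ≤ ℓ.op a' b := by
  cases ℓ
  · exact Nat.add_le_add_right h b
  · exact max_le_max h le_rfl

/-- Aggregation of the first `i` terms of a sequence. -/
def Aggregation.accum (ℓ : Aggregation) (u : ℕ → ℕ) : ℕ → ℕ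
  | 0 => 0
  | i + 1 => ℓ.op (ℓ.accum u i) (u i)

theorem Aggregation.accum_congr (ℓ : Aggregation) {u v : ℕ → ℕ} {n : ℕ}
    (h : ∀ i < n, u i = v i) : ℓ.accum u n = ℓ.accum v n := by
  induction n with
  | zero => rfl
  | succ n ih =>
    simp only [accum]
    rw [ih fun i hi => h i (by omega), h n (by omega)]

theorem Aggregation.eval_eq_accum (ℓ : Aggregation) {n : ℕ} (u : ℕ → ℕ) :
    (ℓ.eval fun i : Fin n => u i) = ℓ.accum u n := by
  cases ℓ
  · simp only [eval]
    induction n with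
    | zero => rfl
    | succ n ih => rw [Fin.sum_univ_castSucc]; simp only [Fin.val_castSucc, Fin.val_last, ih]; rfl
  · simp only [eval]
    induction n with
    | zero => rfl
    | succ n ih =>
      rw [Fin.univ_castSuccEmb]
      simp only [Finset.sup_cons, Finset.sup_map, Function.comp_def, Fin.val_last,
        Fin.coe_castSuccEmb, Fin.val_castSucc, ih]
      exact max_comm _ _

theorem Aggregation.eval_mono (ℓ : Aggregation) {n : ℕ} {f g : Fin n → ℕ} (h : ∀ i, f i ≤ g i) :
    ℓ.eval f ≤ ℓ.eval g := by
  cases ℓ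
  · exact Finset.sum_le_sum fun i _ => h i
  · exact Finset.sup_mono_fun fun i _ => h i

/-! ### The dynamic program -/

/-- The first minimizer of `g` on `{0, …, c - 1}`, as found by a linear scan. -/
def argminBelow (g : ℕ → ℕ) : ℕ → ℕ
  | 0 => 0
  | c + 1 => if g c < g (argminBelow g c) then c else argminBelow g c

theorem argminBelow_le (g : ℕ → ℕ) (c : ℕ) : argminBelow g c ≤ c := by
  induction c with
  | zero => exact le_rfl
  | succ c ih => rw [argminBelow]; split_ifs <;> omega

theorem argminBelow_lt (g : ℕ → ℕ) {c : ℕ} (h : 0 < c) : argminBelow g c < c := by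
  obtain ⟨c, rfl⟩ := Nat.exists_eq_succ_of_ne_zero h.ne'
  have := argminBelow_le g c
  rw [Nat.succ_eq_add_one, argminBelow]; split_ifs <;> omega

theorem apply_argminBelow_le (g : ℕ → ℕ) {b c : ℕ} (h : b < c) : g (argminBelow g c) ≤ g b := by
  induction c with
  | zero => omega
  | succ c ih =>
    rw [argminBelow]
    rcases Nat.lt_succ_iff_lt_or_eq.1 h with h | rfl
    · have := ih h
      split_ifs <;> omega
    · split_ifs <;> omega

/-- The state from which state `(t, c)` of the next voter is reached best: either `(t, c)` itself,
or, with one change less available, the best candidate of layer `t - 1`. -/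
def dpPred (m : ℕ) (F : ℕ → ℕ → ℕ) (t c : ℕ) : ℕ × ℕ :=
  if 0 < t ∧ F (t - 1) (argminBelow (F (t - 1)) m) < F t c then
    (t - 1, argminBelow (F (t - 1)) m) else (t, c)

/-- `dpTable ℓ m w i t c` is the least aggregated cost of the first `i` voters when the last of
them is assigned to `c` and the assignment changes at most `t` times. -/
def dpTable (ℓ : Aggregation) (m : ℕ) (w : ℕ → ℕ → ℕ) : ℕ → ℕ → ℕ → ℕ
  | 0, _, _ => 0
  | i + 1, t, c =>
    ℓ.op (dpTable ℓ m w i (dpPred m (dpTable ℓ m w i) t c).1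
      (dpPred m (dpTable ℓ m w i) t c).2) (w i c)

/-- The assignment found by following `dpPred` backwards. -/
def dpTrace (ℓ : Aggregation) (m : ℕ) (w : ℕ → ℕ → ℕ) : ℕ → ℕ → ℕ → ℕ → ℕ
  | 0, _, _ => fun _ => 0
  | i + 1, t, c =>
    Function.update (dpTrace ℓ m w i (dpPred m (dpTable ℓ m w i) t c).1
      (dpPred m (dpTable ℓ m w i) t c).2) i c

theorem dpPred_snd_lt {m : ℕ} (F : ℕ → ℕ → ℕ) {t c : ℕ} (hc : c < m) :
    (dpPred m F t c).2 < m := by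
  rw [dpPred]
  split_ifs
  · exact argminBelow_lt _ (by omega)
  · exact hc

theorem dpPred_fst_le (m : ℕ) (F : ℕ → ℕ → ℕ) (t c : ℕ) : (dpPred m F t c).1 ≤ t := by
  rw [dpPred]
  split_ifs
  · exact Nat.sub_le _ _
  · exact le_rfl

theorem dpPred_fst_add_one_le (m : ℕ) (F : ℕ → ℕ → ℕ) (t c : ℕ)
    (h : (dpPred m F t c).2 ≠ c) : (dpPred m F t c).1 + 1 ≤ t := by
  rw [dpPred] at h ⊢
  split_ifs at h ⊢ with h1
  · simp only; omega
  · exact absurd rfl h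

theorem apply_dpPred_le_self (m : ℕ) (F : ℕ → ℕ → ℕ) (t c : ℕ) :
    F (dpPred m F t c).1 (dpPred m F t c).2 ≤ F t c := by
  rw [dpPred]
  split_ifs with h1
  · exact h1.2.le
  · exact le_rfl

/-- Layer t + 1 may switch from any candidate b of layer t, and the predecessor is at least as good
as the best of these. If the switch is not taken, staying was no worse. -/
theorem apply_dpPred_le (m : ℕ) (F : ℕ → ℕ → ℕ) (t c : ℕ) {b : ℕ} (hb : b < m) :
    F (dpPred m F (t + 1) c).1 (dpPred m F (t + 1) c).2 ≤ F t b := by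
  have := apply_argminBelow_le (F t) hb
  rw [dpPred]
  split_ifs with h1
  · exact this
  · simp only [Nat.add_sub_cancel] at h1 ⊢; omega

section
variable (ℓ : Aggregation) (m : ℕ) (w : ℕ → ℕ → ℕ)

theorem dpTrace_lt (i t : ℕ) {c : ℕ} (hc : c < m) (x : ℕ) : dpTrace ℓ m w i t c x < m := by
  induction i generalizing t c with
  | zero => simp only [dpTrace]; omega
  | succ i ih =>
    rw [dpTrace, Function.update_apply]
    split_ifs
    · exact hc
    · exact ih _ (dpPred_snd_lt _ hc)

theorem accum_dpTrace (i t c : ℕ) :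
    ℓ.accum (fun x => w x (dpTrace ℓ m w i t c x)) i = dpTable ℓ m w i t c := by
  induction i generalizing t c with
  | zero => rfl
  | succ i ih =>
    rw [Aggregation.accum, dpTable, ← ih]
    congr 1
    · refine ℓ.accum_congr fun x hx => ?_
      rw [dpTrace, Function.update_of_ne (by omega)]
    · rw [dpTrace, Function.update_self]

/-- A step back either keeps the candidate or lowers the layer by at least one, so each new value is
paid for by a layer. Inserting c makes the induction start at i = 0, where the image is empty. -/
theorem card_image_dpTrace_le (i t c : ℕ) :
    (insert c ((Finset.range i).image (dpTrace ℓ m w i t c))).card ≤ t + 1 := by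
  induction i generalizing t c with
  | zero => simp
  | succ i ih =>
    set q := dpPred m (dpTable ℓ m w i) t c with hq
    have hsub : insert c ((Finset.range (i + 1)).image (dpTrace ℓ m w (i + 1) t c)) ⊆
        insert c (insert q.2 ((Finset.range i).image (dpTrace ℓ m w i q.1 q.2))) := by
      intro y hy
      simp only [Finset.mem_insert, Finset.mem_image, Finset.mem_range, dpTrace] at hy ⊢
      rcases hy with hy | ⟨x, hx, rfl⟩
      · exact Or.inl hy
      · rcases Nat.lt_succ_iff_lt_or_eq.1 hx with hx | rfl
        · rw [Function.update_of_ne (by omega)]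
          exact Or.inr (Or.inr ⟨x, hx, rfl⟩)
        · simp
    refine (Finset.card_le_card hsub).trans ?_
    by_cases hc : q.2 = c
    · have h1 := ih q.1 q.2
      have h2 : q.1 ≤ t := dpPred_fst_le m _ t c
      rw [hc] at h1 ⊢
      rw [Finset.insert_idem]
      omega
    · have h1 := ih q.1 q.2
      have h2 : q.1 + 1 ≤ t := dpPred_fst_add_one_le m _ t c hc
      exact (Finset.card_insert_le _ _).trans (by omega)

/-! ### The table as a lower bound, and counting changes -/

/-- The number of changes in `g 0, …, g i`. -/
def changes (g : ℕ → ℕ) : ℕ → ℕ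
  | 0 => 0
  | i + 1 => changes g i + if g i = g (i + 1) then 0 else 1

/-- Follow g through the table: where g does not change, staying in the state is allowed; where it
changes, one layer is spent and `apply_dpPred_le` applies. The first candidate is free because row 0
vanishes. -/
theorem dpTable_le_accum {g : ℕ → ℕ} (hg : ∀ i, g i < m) (i t : ℕ) (ht : changes g i ≤ t) :
    dpTable ℓ m w (i + 1) t (g i) ≤ ℓ.accum (fun x => w x (g x)) (i + 1) := by
  induction i generalizing t with
  | zero => simp [dpTable, Aggregation.accum]
  | succ i ih =>
    rw [dpTable, Aggregation.accum]
    refine ℓ.op_mono ?_ _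
    rw [changes] at ht
    split_ifs at ht with h
    · refine (apply_dpPred_le_self m _ _ _).trans ?_
      rw [← h]
      exact ih t (by omega)
    · obtain ⟨t, rfl⟩ : ∃ u, t = u + 1 := ⟨t - 1, by omega⟩
      exact (apply_dpPred_le m _ t _ (hg i)).trans (ih t (by omega))

/-- Every change produces a value not seen before: if g (i + 1) equalled an earlier g x,
monotonicity of the rank r would squeeze g i to the same rank, hence to the same value. -/
theorem changes_lt_card_image {g : ℕ → ℕ} {r : ℕ → ℕ} (i : ℕ)
    (hr : ∀ x y, x ≤ y → y ≤ i → r (g x) ≤ r (g y))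
    (hinj : ∀ x y, x ≤ i → y ≤ i → r (g x) = r (g y) → g x = g y) :
    changes g i < ((Finset.range (i + 1)).image g).card := by
  induction i with
  | zero => simp [changes]
  | succ i ih =>
    have := ih (fun x y h h' => hr x y h (by omega))
      (fun x y h h' => hinj x y (by omega) (by omega))
    rw [changes, Finset.range_add_one, Finset.image_insert]
    split_ifs with h
    · exact lt_of_lt_of_le this (Finset.card_le_card (Finset.subset_insert _ _))
    · rw [Finset.card_insert_of_notMem]
      · omega
      · simp only [Finset.mem_image, Finset.mem_range, not_exists, not_and]
        intro x hx hxe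
        refine h (hinj _ _ (by omega) le_rfl (le_antisymm (hr _ _ (by omega) le_rfl) ?_))
        rw [← hxe]
        exact hr _ _ (by omega) (by omega)

end

/-! ### Single-crossing elections -/

/-- The dissatisfaction of voter `i` with candidate `c`, with junk value `0` out of range. -/
def Election.cost (E : Election) (α : Fin E.m → ℕ) (i c : ℕ) : ℕ :=
  if h : i < E.n ∧ c < E.m then α (E.pos ⟨i, h.1⟩ ⟨c, h.2⟩) else 0

theorem Election.dissatisfaction_eq_accum (E : Election) (α : Fin E.m → ℕ) (ℓ : Aggregation)
    (Φ : Fin E.n → Fin E.m) (g : ℕ → ℕ) (hg : ∀ i, (Φ i : ℕ) = g i) :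
    E.dissatisfaction α ℓ Φ = ℓ.accum (fun x => E.cost α x (g x)) E.n := by
  rw [← ℓ.eval_eq_accum, dissatisfaction]
  congr 1
  funext i
  rw [cost, dif_pos ⟨i.2, by rw [← hg]; exact (Φ i).2⟩]
  simp only [← hg]

theorem Election.card_image_eq (E : Election) (Φ : Fin E.n → Fin E.m) (g : ℕ → ℕ)
    (hg : ∀ i, (Φ i : ℕ) = g i) :
    (Finset.univ.image Φ).card = ((Finset.range E.n).image g).card := by
  rw [← Finset.card_image_of_injective _ Fin.val_injective, Finset.image_image]
  congr 1
  ext y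
  simp only [Finset.mem_image, Finset.mem_univ, true_and, Finset.mem_range, Function.comp_apply, hg]
  exact ⟨fun ⟨i, h⟩ => ⟨i, i.2, h⟩, fun ⟨i, hi, h⟩ => ⟨⟨i, hi⟩, h⟩⟩

/-- In a single-crossing election, the favourites within a fixed committee move down the preference
order of the first voter. -/
theorem Election.SingleCrossing.favourite_mono {E : Election} (hE : E.SingleCrossing)
    (S : Finset (Fin E.m)) (Φ : Fin E.n → Fin E.m) (hS : ∀ i, Φ i ∈ S)
    (hΦ : ∀ i, ∀ c ∈ S, E.pos i (Φ i) ≤ E.pos i c) {i j : Fin E.n} (hij : i ≤ j) :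
    E.pos ⟨0, E.n_pos⟩ (Φ i) ≤ E.pos ⟨0, E.n_pos⟩ (Φ j) := by
  -- If the first voter ranks Φ j above Φ i, the voters preferring Φ j to Φ i form an initial
  -- segment. It misses i, whose favourite is Φ i, hence also the later voter j. As Φ j is the
  -- favourite of j, the two candidates coincide.
  by_contra! h
  obtain ⟨t, -, -, ht⟩ := hE (Φ j) (Φ i) h
  have hi : ¬ (i : ℕ) < t := fun hlt => absurd ((ht i).2 hlt) (not_lt.2 (hΦ i _ (hS j)))
  have hj : ¬ E.Prefers j (Φ j) (Φ i) := fun hp =>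
    hi (lt_of_le_of_lt (Fin.le_def.1 hij) ((ht j).1 hp))
  have heq : E.pos j (Φ j) = E.pos j (Φ i) :=
    le_antisymm (hΦ j _ (hS i)) (not_lt.1 hj)
  have : Φ j = Φ i := (E.vote j).symm.injective heq
  rw [this] at h
  exact lt_irrefl _ h

theorem Election.exists_favourite (E : Election) (Ψ : Fin E.n → Fin E.m) :
    ∃ Φ : Fin E.n → Fin E.m, (∀ i, Φ i ∈ Finset.univ.image Ψ) ∧
      ∀ i, ∀ c ∈ Finset.univ.image Ψ, E.pos i (Φ i) ≤ E.pos i c := by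
  have : ∀ i, ∃ a ∈ Finset.univ.image Ψ, ∀ c ∈ Finset.univ.image Ψ, E.pos i a ≤ E.pos i c :=
    fun i => Finset.exists_min_image _ _ ⟨Ψ i, Finset.mem_image_of_mem _ (Finset.mem_univ _)⟩
  choose Φ h1 h2 using this
  exact ⟨Φ, h1, h2⟩

/-- The assignment computed by the dynamic program. -/
def Election.solution (E : Election) (α : Fin E.m → ℕ) (ℓ : Aggregation) (K : ℕ) : ℕ → ℕ :=
  dpTrace ℓ E.m (E.cost α) E.n (K - 1)
    (argminBelow (dpTable ℓ E.m (E.cost α) E.n (K - 1)) E.m)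

theorem Election.solution_lt (E : Election) (α : Fin E.m → ℕ) (ℓ : Aggregation) (K x : ℕ) :
    E.solution α ℓ K x < E.m :=
  dpTrace_lt _ _ _ _ _ (argminBelow_lt _ E.m_pos) _

/-- Any competitor is first replaced by the favourites within its image, which are no worse since α
is nondecreasing. These have fewer changes than values, so the table bounds them from below. -/
theorem Election.SingleCrossing.isOptimalCC_solution {E : Election} (hE : E.SingleCrossing)
    {α : Fin E.m → ℕ} (hα : IsDissatisfaction α) (ℓ : Aggregation) {k : ℕ} (hk : 0 < k) :
    E.IsOptimalCC α ℓ k fun i => ⟨E.solution α ℓ (min k E.n) i, E.solution_lt α ℓ _ _⟩ := by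
  have hn := E.n_pos
  obtain ⟨K, hK⟩ : ∃ K, min k E.n = K + 1 := ⟨min k E.n - 1, by omega⟩
  constructor
  · rw [IsCCAssignment, E.card_image_eq _ (E.solution α ℓ (min k E.n)) fun _ => rfl]
    refine (Finset.card_le_card (Finset.subset_insert _ _)).trans
      ((card_image_dpTrace_le ℓ E.m (E.cost α) E.n _ _).trans ?_)
    omega
  · intro Ψ hΨ
    obtain ⟨Φ, hS, hΦ⟩ := E.exists_favourite Ψ
    have hle : E.dissatisfaction α ℓ Φ ≤ E.dissatisfaction α ℓ Ψ :=
      ℓ.eval_mono fun i => hα.1 (hΦ i _ (Finset.mem_image_of_mem _ (Finset.mem_univ _)))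
    refine le_trans ?_ hle
    -- There are at most n values anyway, so the cap min k n loses nothing.
    have hcard : (Finset.univ.image Φ).card ≤ min k E.n := by
      refine le_min ((Finset.card_le_card ?_).trans hΨ)
        (Finset.card_image_le.trans (by simp))
      exact Finset.image_subset_iff.2 fun i _ => hS i
    obtain ⟨N, hN⟩ : ∃ N, E.n = N + 1 := ⟨E.n - 1, by omega⟩
    -- Beyond the last voter g takes the junk value 0, which is still a candidate because m is
    -- positive.
    let g : ℕ → ℕ := fun x => if h : x < E.n then Φ ⟨x, h⟩ else 0
    have hgΦ : ∀ i : Fin E.n, (Φ i : ℕ) = g i := fun i => by simp [g]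
    have hgx : ∀ x (h : x < E.n), g x = Φ ⟨x, h⟩ := fun x h => by simp [g, h]
    have hg : ∀ x, g x < E.m := fun x => by
      by_cases h : x < E.n
      · rw [hgx x h]; exact Fin.isLt _
      · simp [g, h, E.m_pos]
    let r : ℕ → ℕ := fun c => if h : c < E.m then E.pos ⟨0, hn⟩ ⟨c, h⟩ else 0
    have hr : ∀ x (h : x < E.n), r (g x) = E.pos ⟨0, hn⟩ (Φ ⟨x, h⟩) := fun x h => by
      simp [r, hgx x h]
    have hch : changes g N < ((Finset.range (N + 1)).image g).card := by
      refine changes_lt_card_image (r := r) N (fun x y hxy hy => ?_) fun x y hx hy h => ?_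
      · rw [hr x (by omega), hr y (by omega)]
        exact hE.favourite_mono _ Φ hS hΦ (Fin.mk_le_mk.2 hxy)
      · rw [hr x (by omega), hr y (by omega)] at h
        rw [hgx x (by omega), hgx y (by omega),
          (E.vote ⟨0, hn⟩).symm.injective (Fin.val_injective h)]
    rw [← hN, ← E.card_image_eq Φ g hgΦ] at hch
    rw [E.dissatisfaction_eq_accum α ℓ _ (E.solution α ℓ (min k E.n)) fun _ => rfl,
      E.dissatisfaction_eq_accum α ℓ Φ g hgΦ, solution, accum_dpTrace]
    refine (apply_argminBelow_le _ (hg N)).trans ?_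
    rw [hN]
    exact dpTable_le_accum ℓ E.m _ hg N _ (by omega)

/-! ### Reasoning about programs -/

/-- Started in `s`, the program halts within `B` steps, in a memory satisfying `Q`. -/
def Program.Runs (P : Program) (s : Mem) (B : ℕ) (Q : Mem → Prop) : Prop :=
  ∃ (s' : Mem) (t : ℕ), Exec P s s' t ∧ t ≤ B ∧ Q s'

theorem Program.Runs.mono {P : Program} {s : Mem} {B B' : ℕ} {Q Q' : Mem → Prop}
    (h : P.Runs s B Q) (hB : B ≤ B') (hQ : ∀ s', Q s' → Q' s') : P.Runs s B' Q' := by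
  obtain ⟨s', t, hE, ht, hs⟩ := h
  exact ⟨s', t, hE, ht.trans hB, hQ _ hs⟩

theorem Program.Runs.seq {P P' : Program} {s : Mem} {B B' : ℕ} {Q R : Mem → Prop}
    (h : P.Runs s B Q) (h' : ∀ s', Q s' → P'.Runs s' B' R) :
    (Program.seq P P').Runs s (B + B') R := by
  obtain ⟨s', t, hE, ht, hs⟩ := h
  obtain ⟨s'', t', hE', ht', hs'⟩ := h' s' hs
  exact ⟨s'', t + t', hE.seq hE', Nat.add_le_add ht ht', hs'⟩

/-- A loop that is executed `N` times. -/
theorem Program.Runs.whileLT {x y N B : ℕ} {P : Program} (I : ℕ → Mem → Prop)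
    (hstep : ∀ j < N, ∀ s, I j s → s.reg x < s.reg y ∧ P.Runs s B (I (j + 1)))
    (hexit : ∀ s, I N s → ¬ s.reg x < s.reg y) {s : Mem} (h0 : I 0 s) :
    (Program.whileLT x y P).Runs s (N * (B + 1) + 1) (I N) := by
  suffices ∀ d j, j + d = N → ∀ s, I j s →
      (Program.whileLT x y P).Runs s (d * (B + 1) + 1) (I N) from this N 0 (zero_add N) s h0
  intro d
  induction d with
  | zero =>
    rintro j rfl s hs
    exact ⟨s, 1, .whileFalse (hexit s hs), by omega, hs⟩
  | succ d ih =>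
    intro j hj s hs
    obtain ⟨hlt, s', t, hE, ht, hs'⟩ := hstep j (by omega) s hs
    obtain ⟨s'', t', hE', ht', hs''⟩ := ih (j + 1) (by omega) s' hs'
    refine ⟨s'', t + t' + 1, .whileTrue hlt hE hE', ?_, hs''⟩
    rw [Nat.succ_mul]
    omega

/-- Programs without loops. -/
def Program.LoopFree : Program → Prop
  | .seq P Q => P.LoopFree ∧ Q.LoopFree
  | .ifLT _ _ P Q => P.LoopFree ∧ Q.LoopFree
  | .whileLT _ _ _ => False
  | _ => True

/-- The effect of a program without loops. -/
def Program.eval : Program → Mem → Mem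
  | .skip, s => s
  | .const x c, s => s.setReg x c
  | .add x y z, s => s.setReg x (s.reg y + s.reg z)
  | .sub x y z, s => s.setReg x (s.reg y - s.reg z)
  | .load x a y, s => s.setReg x (s.arr a (s.reg y))
  | .store a x y, s => s.setArr a (s.reg x) (s.reg y)
  | .seq P Q, s => Q.eval (P.eval s)
  | .ifLT x y P Q, s => if s.reg x < s.reg y then P.eval s else Q.eval s
  | .whileLT _ _ _, s => s

/-- A bound for the number of steps of a program without loops. -/
def Program.size : Program → ℕ
  | .seq P Q => P.size + Q.size
  | .ifLT _ _ P Q => P.size + Q.size + 1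
  | _ => 1

/-- Straight-line code is thereby verified by simplifying `eval`; only loops need invariants. The
bound `size` adds both branches of a test. -/
theorem Program.LoopFree.exec {P : Program} (hP : P.LoopFree) (s : Mem) :
    ∃ t ≤ P.size, Exec P s (P.eval s) t := by
  induction P generalizing s with
  | skip => exact ⟨1, le_rfl, .skip s⟩
  | const x c => exact ⟨1, le_rfl, .const s x c⟩
  | add x y z => exact ⟨1, le_rfl, .add s x y z⟩
  | sub x y z => exact ⟨1, le_rfl, .sub s x y z⟩
  | load x a y => exact ⟨1, le_rfl, .load s x a y⟩
  | store a x y => exact ⟨1, le_rfl, .store s a x y⟩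
  | seq P Q ihP ihQ =>
    obtain ⟨t, ht, h⟩ := ihP hP.1 s
    obtain ⟨u, hu, h'⟩ := ihQ hP.2 (P.eval s)
    exact ⟨t + u, Nat.add_le_add ht hu, h.seq h'⟩
  | ifLT x y P Q ihP ihQ =>
    rw [eval, size]
    split_ifs with hlt
    · obtain ⟨t, ht, h⟩ := ihP hP.1 s
      exact ⟨t + 1, by omega, .ifTrue hlt h⟩
    · obtain ⟨t, ht, h⟩ := ihQ hP.2 s
      exact ⟨t + 1, by omega, .ifFalse hlt h⟩
  | whileLT => exact hP.elim

theorem Program.LoopFree.runs {P : Program} (hP : P.LoopFree) {s : Mem} {Q : Mem → Prop}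
    (hQ : Q (P.eval s)) : P.Runs s P.size Q := by
  obtain ⟨t, ht, h⟩ := hP.exec s
  exact ⟨_, t, h, ht, hQ⟩

@[simp] theorem Mem.reg_setReg (s : Mem) (x v y : ℕ) :
    (s.setReg x v).reg y = if y = x then v else s.reg y :=
  Function.update_apply _ _ _ _

@[simp] theorem Mem.arr_setReg (s : Mem) (x v : ℕ) : (s.setReg x v).arr = s.arr := rfl

@[simp] theorem Mem.reg_setArr (s : Mem) (a i v : ℕ) : (s.setArr a i v).reg = s.reg := rfl

@[simp] theorem Mem.arr_setArr (s : Mem) (a i v b : ℕ) :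
    (s.setArr a i v).arr b = if b = a then Function.update (s.arr a) i v else s.arr b := by
  simp only [setArr, Function.update_apply]

/-! ### The registers and arrays of the algorithm -/

-- These are bare numerals, so that simplification decides whether two of them coincide. Register 1
-- and array 1 are left for the output.
notation "rM" => 2
notation "rN" => 3
notation "rK" => 4
notation "rZero" => 5
notation "rOne" => 6
notation "rStride" => 7
notation "rVotes" => 8
notation "rState" => 9
notation "rLayer" => 10
notation "rVoter" => 11
notation "rRank" => 12
notation "rT" => 13
notation "rCand" => 14
notation "rSwitch" => 15
notation "rSwitchVal" => 16
notation "rBest" => 17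
notation "rPred" => 18
notation "rVal" => 19
notation "rTmp" => 20
notation "aIn" => 0
notation "aOut" => 1
notation "aDissat" => 2
notation "aCost" => 3
notation "aVal" => 4
notation "aPred" => 5
notation "aCand" => 6
notation "aBest" => 7

/-! ### Flat indices -/

section
variable (ℓ : Aggregation) (m K : ℕ) (w : ℕ → ℕ → ℕ)

/-- The position of state `(t, c)` of voter `i` in the flat tables. -/
def flat (i t c : ℕ) : ℕ := (i * K + t) * m + c

/-- The flat table of values. -/
def valTable (p : ℕ) : ℕ := dpTable ℓ m w (p / m / K) (p / m % K) (p % m)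

/-- The flat table of predecessors, for states beyond the first row. -/
def predTable (p : ℕ) : ℕ :=
  let q := dpPred m (dpTable ℓ m w (p / m / K - 1)) (p / m % K) (p % m)
  flat m K (p / m / K - 1) q.1 q.2

/-- The flat table of the best states of each layer. -/
def bestTable (q : ℕ) : ℕ :=
  q * m + argminBelow (dpTable ℓ m w (q / K) (q % K)) m

variable {m K}

theorem flat_mod (i t : ℕ) {c : ℕ} (hc : c < m) : flat m K i t c % m = c := by
  rw [flat, Nat.add_comm, Nat.add_mul_mod_self_right, Nat.mod_eq_of_lt hc]

theorem flat_div (i t : ℕ) {c : ℕ} (hc : c < m) : flat m K i t c / m = i * K + t := by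
  rw [flat, Nat.add_comm, Nat.add_mul_div_right _ _ (by omega), Nat.div_eq_of_lt hc, zero_add]

theorem mul_add_div_of_lt (i : ℕ) {t : ℕ} (ht : t < K) : (i * K + t) / K = i := by
  rw [Nat.add_comm, Nat.add_mul_div_right _ _ (by omega), Nat.div_eq_of_lt ht, zero_add]

theorem mul_add_mod_of_lt (i : ℕ) {t : ℕ} (ht : t < K) : (i * K + t) % K = t := by
  rw [Nat.add_comm, Nat.add_mul_mod_self_right, Nat.mod_eq_of_lt ht]

theorem valTable_flat (i : ℕ) {t c : ℕ} (ht : t < K) (hc : c < m) :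
    valTable ℓ m K w (flat m K i t c) = dpTable ℓ m w i t c := by
  rw [valTable, flat_mod i t hc, flat_div i t hc, mul_add_div_of_lt i ht, mul_add_mod_of_lt i ht]

theorem predTable_flat (i : ℕ) {t c : ℕ} (ht : t < K) (hc : c < m) :
    predTable ℓ m K w (flat m K (i + 1) t c) =
      flat m K i (dpPred m (dpTable ℓ m w i) t c).1 (dpPred m (dpTable ℓ m w i) t c).2 := by
  rw [predTable, flat_mod _ t hc, flat_div _ t hc, mul_add_div_of_lt _ ht, mul_add_mod_of_lt _ ht]
  rfl

theorem bestTable_flat (i : ℕ) {t : ℕ} (ht : t < K) :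
    bestTable ℓ m K w (i * K + t) = flat m K i t (argminBelow (dpTable ℓ m w i t) m) := by
  rw [bestTable, mul_add_div_of_lt _ ht, mul_add_mod_of_lt _ ht, flat]

/-- Whole rows precede each other in the flat order, so all predecessors of a state are already
filled in when it is reached. -/
theorem flat_lt_flat (i : ℕ) {t t' c c' : ℕ} (ht : t < K) (hc : c < m) :
    flat m K i t c < flat m K (i + 1) t' c' := by
  have h1 : i * K + t + 1 ≤ (i + 1) * K + t' := by rw [Nat.succ_mul]; omega
  have h2 := Nat.mul_le_mul_right m h1
  rw [Nat.add_mul, one_mul] at h2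
  rw [flat, flat]
  omega

/-- The same state one voter earlier lies a constant stride back, so no multiplication is needed to
find it. -/
theorem flat_succ_sub (i t c : ℕ) : flat m K (i + 1) t c - K * m = flat m K i t c := by
  rw [flat, flat, Nat.succ_mul, Nat.add_right_comm, Nat.add_mul _ K, Nat.add_right_comm,
    Nat.add_sub_cancel]

end

/-! ### The core program -/

/-- `reg x := op (reg y) (reg z)`. -/
def Program.combine : Aggregation → ℕ → ℕ → ℕ → Program
  | .l1, x, y, z => .add x y z
  | .linf, x, y, z => .ifLT y z (.add x z rZero) (.add x y rZero)

/-- Choose the best predecessor of a state. -/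
def Program.choosePred : Program :=
  .seq (.sub rPred rState rStride) <|
  .seq (.load rVal aVal rPred) <|
  .ifLT rZero rT
    (.ifLT rSwitchVal rVal (.seq (.add rPred rSwitch rZero) (.add rVal rSwitchVal rZero)) .skip)
    .skip

/-- Fill in the table entries of a state. -/
def Program.fillState : Program :=
  .seq (.store aVal rState rVal) <|
  .seq (.store aPred rState rPred) <|
  .seq (.store aCand rState rCand) <|
  .seq (.load rTmp aVal rBest) <|
  .seq (.ifLT rVal rTmp (.add rBest rState rZero) .skip) <|
  .seq (.add rState rState rOne) (.add rCand rCand rOne)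

/-- Process one state. -/
def Program.processState (ℓ : Aggregation) : Program :=
  .seq .choosePred <|
  .seq (.seq (.load rTmp aCost rCand) (.combine ℓ rVal rVal rTmp)) .fillState

/-- Process all states of one layer. -/
def Program.processLayer (ℓ : Aggregation) : Program :=
  .seq (.seq (.sub rSwitch rLayer rK) <|
    .seq (.sub rSwitch rSwitch rOne) <|
    .seq (.load rSwitch aBest rSwitch) <|
    .seq (.load rSwitchVal aVal rSwitch) <|
    .seq (.const rCand 0) (.add rBest rState rZero)) <|
  .seq (.whileLT rCand rM (.processState ℓ)) <|
  .seq (.store aBest rLayer rBest) <|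
  .seq (.add rLayer rLayer rOne) (.add rT rT rOne)

/-- Tabulate the costs of one voter. -/
def Program.readVote : Program :=
  .seq (.const rRank 0) <|
  .whileLT rRank rM <|
    .seq (.load rTmp aDissat rRank) <|
    .seq (.load rCand aIn rVotes) <|
    .seq (.store aCost rCand rTmp) <|
    .seq (.add rVotes rVotes rOne) (.add rRank rRank rOne)

/-- Process all layers of one voter. -/
def Program.processVoter (ℓ : Aggregation) : Program :=
  .seq .readVote <|
  .seq (.const rT 0) <|
  .seq (.whileLT rT rK (.processLayer ℓ)) (.add rVoter rVoter rOne)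

/-- Set up the registers and the first row of the table. -/
def Program.initTables : Program :=
  .seq (.seq (.const rZero 0) <|
    .seq (.const rOne 1) <|
    .seq (.ifLT rN rK (.add rK rN rZero) .skip) <|
    .seq (.const rState 0) <|
    .seq (.const rLayer 0) (.const rVoter 0)) <|
  .seq (.whileLT rLayer rK <|
    .seq (.store aBest rLayer rState) <|
    .seq (.add rState rState rM) (.add rLayer rLayer rOne)) <|
  .add rStride rState rZero

/-- Read off the assignment. -/
def Program.traceBack : Program :=
  .seq (.seq (.sub rLayer rLayer rOne) (.load rState aBest rLayer)) <|
  .seq (.whileLT rZero rVoter <|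
    .seq (.sub rVoter rVoter rOne) <|
    .seq (.load rCand aCand rState) <|
    .seq (.store aOut rVoter rCand) (.load rState aPred rState)) <|
  .add 1 rN rZero

/-- The dynamic program, given `m`, `n`, `k`, the dissatisfaction function, and the votes. -/
def Program.core (ℓ : Aggregation) : Program :=
  .seq .initTables <|
  .seq (.whileLT rVoter rN (.processVoter ℓ)) .traceBack

/-! ### Correctness of the core program -/

section
variable (ℓ : Aggregation) (m n K base : ℕ) (A X : ℕ → ℕ) (w : ℕ → ℕ → ℕ)

/-- The part of the memory that does not change during the main loop. -/
structure Env (s : Mem) : Prop where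
  hM : s.reg rM = m
  hN : s.reg rN = n
  hK : s.reg rK = K
  hZero : s.reg rZero = 0
  hOne : s.reg rOne = 1
  hStride : s.reg rStride = K * m
  hDissat : s.arr aDissat = A
  hIn : s.arr aIn = X

/-- The tables are filled in for the states below `p` and the layers below `q`. -/
structure Tables (p q : ℕ) (s : Mem) : Prop where
  hState : s.reg rState = p
  hLayer : s.reg rLayer = q
  hVal : ∀ x < p, s.arr aVal x = valTable ℓ m K w x
  hPred : ∀ x < p, K * m ≤ x → s.arr aPred x = predTable ℓ m K w x
  hCand : ∀ x < p, K * m ≤ x → s.arr aCand x = x % m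
  hBest : ∀ x < q, s.arr aBest x = bestTable ℓ m K w x

/-- The invariant of the loop over the voters. -/
structure VoterInv (i : ℕ) (s : Mem) : Prop extends Env m n K A X s,
    Tables ℓ m K w ((i + 1) * K * m) ((i + 1) * K) s where
  hVoter : s.reg rVoter = i
  hVotes : s.reg rVotes = base + i * m

/-- The invariant of the loop over the positions. -/
structure RankInv (i r : ℕ) (s : Mem) : Prop extends Env m n K A X s,
    Tables ℓ m K w ((i + 1) * K * m) ((i + 1) * K) s where
  hVoter : s.reg rVoter = i
  hVotes : s.reg rVotes = base + i * m + r
  hRank : s.reg rRank = r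
  hCost : ∀ x < r, s.arr aCost (X (base + i * m + x)) = w i (X (base + i * m + x))

/-- The invariant of the loop over the layers. -/
structure LayerInv (i t : ℕ) (s : Mem) : Prop extends Env m n K A X s,
    Tables ℓ m K w (((i + 1) * K + t) * m) ((i + 1) * K + t) s where
  hVoter : s.reg rVoter = i
  hVotes : s.reg rVotes = base + (i + 1) * m
  hT : s.reg rT = t
  hCost : ∀ c < m, s.arr aCost c = w i c

/-- The invariant of the loop over the states of a layer. -/
structure StateInv (i t c : ℕ) (s : Mem) : Prop extends Env m n K A X s,
    Tables ℓ m K w (flat m K (i + 1) t c) ((i + 1) * K + t) s where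
  hVoter : s.reg rVoter = i
  hVotes : s.reg rVotes = base + (i + 1) * m
  hT : s.reg rT = t
  hCost : ∀ c < m, s.arr aCost c = w i c
  hCandidate : s.reg rCand = c
  hBestState : s.reg rBest =
    flat m K (i + 1) t (argminBelow (dpTable ℓ m w (i + 1) t) c)
  hSwitch : 0 < t → s.reg rSwitch =
    flat m K i (t - 1) (argminBelow (dpTable ℓ m w i (t - 1)) m)
  hSwitchVal : 0 < t → s.reg rSwitchVal =
    dpTable ℓ m w i (t - 1) (argminBelow (dpTable ℓ m w i (t - 1)) m)

variable {ℓ m n K base A X w}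

theorem Program.runs_combine (s : Mem) (hz : s.reg rZero = 0) {x y z : ℕ} :
    (Program.combine ℓ x y z).Runs s 3 fun s' =>
      s' = s.setReg x (ℓ.op (s.reg y) (s.reg z)) := by
  cases ℓ
  · exact (LoopFree.runs (P := .add x y z) (Q := fun s' => s' = s.setReg x (s.reg y + s.reg z))
      trivial rfl).mono (by simp [size]) fun _ h => h
  · refine (LoopFree.runs (P := .combine .linf x y z) (by simp [combine, LoopFree]) ?_).mono
      (by simp [combine, size]) fun _ h => h
    simp only [combine, eval, Aggregation.op, hz, add_zero]
    split_ifs with h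
    · rw [max_eq_right h.le]
    · rw [max_eq_left (not_lt.1 h)]

theorem StateInv.runs_choosePred {i t c : ℕ} (ht : t < K) (hc : c < m) {s : Mem}
    (h : StateInv ℓ m n K base A X w i t c s) :
    Program.choosePred.Runs s 8 fun s' => s'.arr = s.arr ∧
      (∀ x, x ≠ rPred → x ≠ rVal → s'.reg x = s.reg x) ∧
      s'.reg rPred = predTable ℓ m K w (flat m K (i + 1) t c) ∧
      s'.reg rVal = dpTable ℓ m w i (dpPred m (dpTable ℓ m w i) t c).1
        (dpPred m (dpTable ℓ m w i) t c).2 := by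
  refine (Program.LoopFree.runs (by simp [Program.choosePred, Program.LoopFree]) ?_).mono
    (by decide) fun _ h => h
  rw [predTable_flat ℓ w i ht hc]
  have h1 : s.arr aVal (flat m K i t c) = dpTable ℓ m w i t c := by
    rw [h.hVal _ (flat_lt_flat i ht hc), valTable_flat ℓ w i ht hc]
  have h2 := h.hSwitch
  have h3 := h.hSwitchVal
  simp only [Program.choosePred, Program.eval, Mem.reg_setReg, Mem.arr_setReg, h.hState, h.hStride,
    h.hZero, h.hT, flat_succ_sub, dpPred]
  simp +decide only [if_true, if_false, h1]
  by_cases h0 : 0 < t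
  · rw [if_pos h0, h3 h0]
    by_cases h4 : dpTable ℓ m w i (t - 1) (argminBelow (dpTable ℓ m w i (t - 1)) m) <
        dpTable ℓ m w i t c
    · simp only [h4, h0, and_self, if_true]
      refine ⟨rfl, ?_, ?_, ?_⟩
      · intro x hx hx'; simp [hx, hx']
      · simp [h2 h0]
      · simp
    · simp only [h4, and_false, if_false]
      refine ⟨rfl, ?_, ?_, ?_⟩
      · intro x hx hx'; simp [hx, hx']
      · simp
      · simp
  · simp only [h0, false_and, if_false]
    refine ⟨rfl, ?_, ?_, ?_⟩
    · intro x hx hx'; simp [hx, hx']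
    · simp
    · simp

theorem StateInv.runs_processState {i t c : ℕ} (ht : t < K) (hc : c < m) {s : Mem}
    (h : StateInv ℓ m n K base A X w i t c s) :
    (Program.processState ℓ).Runs s 21 (StateInv ℓ m n K base A X w i t (c + 1)) := by
  refine Program.Runs.mono (B := 8 + (1 + 3 + 9)) ?_ (by omega) fun _ h => h
  refine (h.runs_choosePred ht hc).seq ?_
  rintro s1 ⟨harr, hreg, hpred, hval⟩
  refine Program.Runs.seq (Q := fun s2 => s2.arr = s.arr ∧
      (∀ x, x ≠ rPred → x ≠ rVal → x ≠ rTmp → s2.reg x = s.reg x) ∧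
      s2.reg rPred = predTable ℓ m K w (flat m K (i + 1) t c) ∧
      s2.reg rVal = dpTable ℓ m w (i + 1) t c) ?_ ?_
  · refine Program.Runs.seq (Program.LoopFree.runs (P := .load rTmp aCost rCand) trivial rfl) ?_
    rintro s2 rfl
    refine (Program.runs_combine _ ?_).mono le_rfl ?_
    · simp [Program.eval, hreg, h.hZero]
    rintro s3 rfl
    refine ⟨harr, ?_, ?_, ?_⟩
    · intro x h1 h2 h3; simp [Program.eval, h1, h2, h3, hreg]
    · simp [Program.eval, hpred]
    · simp [Program.eval, hval, hreg, harr, h.hCandidate, h.hCost c hc, dpTable]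
  clear! s1
  rintro s2 ⟨harr, hreg, hpred, hval⟩
  refine (Program.LoopFree.runs (by simp [Program.fillState, Program.LoopFree]) ?_).mono
    (by decide) fun _ h => h
  -- The value at the current best is loaded after the new entry has been stored. The two addresses
  -- coincide exactly when c = 0; the comparison is then of a value with itself and fails, as in
  -- `argminBelow`.
  have hb : Function.update (s.arr aVal) (flat m K (i + 1) t c) (dpTable ℓ m w (i + 1) t c)
      (flat m K (i + 1) t (argminBelow (dpTable ℓ m w (i + 1) t) c)) =
      dpTable ℓ m w (i + 1) t (argminBelow (dpTable ℓ m w (i + 1) t) c) := by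
    rcases (argminBelow_le (dpTable ℓ m w (i + 1) t) c).lt_or_eq with hlt | heq
    · have hlt' : flat m K (i + 1) t (argminBelow (dpTable ℓ m w (i + 1) t) c) <
          flat m K (i + 1) t c := by simpa [flat] using hlt
      rw [Function.update_of_ne hlt'.ne, h.hVal _ hlt', valTable_flat ℓ w _ ht (hlt.trans hc)]
    · rw [heq, Function.update_self]
  have hst : s2.reg rState = flat m K (i + 1) t c := by simp [hreg, h.hState]
  have hcd : s2.reg rCand = c := by simp [hreg, h.hCandidate]
  have hbs : s2.reg rBest = flat m K (i + 1) t (argminBelow (dpTable ℓ m w (i + 1) t) c) := by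
    simp [hreg, h.hBestState]
  have hz : s2.reg rZero = 0 := by simp [hreg, h.hZero]
  have ho : s2.reg rOne = 1 := by simp [hreg, h.hOne]
  have hbest : ∃ s3 : Mem, (Program.fillState.eval s2) = s3 ∧
      s3.arr = (((s2.setArr aVal (flat m K (i + 1) t c) (dpTable ℓ m w (i + 1) t c)).setArr aPred
        (flat m K (i + 1) t c) (predTable ℓ m K w (flat m K (i + 1) t c))).setArr aCand
        (flat m K (i + 1) t c) c).arr ∧
      s3.reg rState = flat m K (i + 1) t (c + 1) ∧ s3.reg rCand = c + 1 ∧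
      s3.reg rBest = flat m K (i + 1) t (argminBelow (dpTable ℓ m w (i + 1) t) (c + 1)) ∧
      ∀ x, x ≠ rState → x ≠ rCand → x ≠ rBest → x ≠ rTmp → s3.reg x = s2.reg x := by
    refine ⟨_, rfl, ?_⟩
    simp only [Program.fillState, Program.eval, Mem.reg_setReg, Mem.arr_setReg, Mem.reg_setArr,
      hst, hcd, hbs, hval, hpred]
    simp +decide only [if_true, if_false, Mem.arr_setArr, harr, hb, argminBelow]
    split_ifs with h1
    · refine ⟨rfl, ?_, ?_, ?_, ?_⟩
      · simp [hst, ho, flat, add_assoc]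
      · simp [hcd, ho]
      · simp [hz]
      · intro x h1 h2 h3 h4; simp [h1, h2, h3, h4]
    · refine ⟨rfl, ?_, ?_, ?_, ?_⟩
      · simp [hst, ho, flat, add_assoc]
      · simp [hcd, ho]
      · simp [hbs]
      · intro x h1 h2 h3 h4; simp [h1, h2, h4]
  obtain ⟨s3, hs3, ha3, hst3, hcd3, hb3, hr3⟩ := hbest
  rw [hs3]
  have key : ∀ x, x < flat m K (i + 1) t (c + 1) → x ≠ flat m K (i + 1) t c →
      x < flat m K (i + 1) t c := by
    intro x hx hne
    simp only [flat, ← add_assoc] at hx hne ⊢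
    omega
  exact
  { hM := by simp [hr3, hreg, h.hM]
    hN := by simp [hr3, hreg, h.hN]
    hK := by simp [hr3, hreg, h.hK]
    hZero := by simp [hr3, hreg, h.hZero]
    hOne := by simp [hr3, hreg, h.hOne]
    hStride := by simp [hr3, hreg, h.hStride]
    hDissat := by simp [ha3, harr, h.hDissat]
    hIn := by simp [ha3, harr, h.hIn]
    hState := hst3
    hLayer := by simp [hr3, hreg, h.hLayer]
    hVal := by
      intro x hx
      simp only [ha3, Mem.arr_setArr]
      simp +decide only [if_true, if_false, harr, Function.update_apply]
      split_ifs with h1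
      · rw [h1, valTable_flat ℓ w _ ht hc]
      · exact h.hVal x (key x hx h1)
    hPred := by
      intro x hx hx'
      simp only [ha3, Mem.arr_setArr]
      simp +decide only [if_true, if_false, harr, Function.update_apply]
      split_ifs with h1
      · rw [h1]
      · exact h.hPred x (key x hx h1) hx'
    hCand := by
      intro x hx hx'
      simp only [ha3, Mem.arr_setArr]
      simp +decide only [if_true, if_false, harr, Function.update_apply]
      split_ifs with h1
      · rw [h1, flat_mod _ _ hc]
      · exact h.hCand x (key x hx h1) hx'
    hBest := by simpa [ha3, harr] using h.hBest
    hVoter := by simp [hr3, hreg, h.hVoter]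
    hVotes := by simp [hr3, hreg, h.hVotes]
    hT := by simp [hr3, hreg, h.hT]
    hCost := by simpa [ha3, harr] using h.hCost
    hCandidate := hcd3
    hBestState := hb3
    hSwitch := by simpa [hr3, hreg] using h.hSwitch
    hSwitchVal := by simpa [hr3, hreg] using h.hSwitchVal }

theorem LayerInv.runs_processLayer (hm : 0 < m) {i t : ℕ} (ht : t < K) {s : Mem}
    (h : LayerInv ℓ m n K base A X w i t s) :
    (Program.processLayer ℓ).Runs s (22 * m + 10)
      (LayerInv ℓ m n K base A X w i (t + 1)) := by
  refine Program.Runs.mono (B := 6 + ((m * (21 + 1) + 1) + 3)) ?_ (by omega) fun _ h => h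
  refine Program.Runs.seq (Q := StateInv ℓ m n K base A X w i t 0) ?_ ?_
  · refine Program.LoopFree.runs (by simp [Program.LoopFree]) ?_
    -- Going back K + 1 layers from layer t of row i + 1 leads to layer t - 1 of row i. For t = 0
    -- the registers hold junk, hence the condition 0 < t, which `choosePred` also tests.
    have hlt : 0 < t → (i + 1) * K + t - K - 1 = i * K + (t - 1) := by
      intro h0; rw [Nat.succ_mul]; omega
    have hsw : 0 < t → s.arr aBest ((i + 1) * K + t - K - 1) =
        flat m K i (t - 1) (argminBelow (dpTable ℓ m w i (t - 1)) m) := by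
      intro h0
      rw [hlt h0, h.hBest _ (by rw [Nat.succ_mul]; omega), bestTable_flat _ _ _ (by omega)]
    have hsv : 0 < t →
        s.arr aVal (flat m K i (t - 1) (argminBelow (dpTable ℓ m w i (t - 1)) m)) =
        dpTable ℓ m w i (t - 1) (argminBelow (dpTable ℓ m w i (t - 1)) m) := by
      intro h0
      rw [h.hVal _ ?_, valTable_flat _ _ _ (by omega) (argminBelow_lt _ hm)]
      exact (flat_lt_flat (t' := t) (c' := 0) i (by omega) (argminBelow_lt _ hm)).trans_eq
        (by simp [flat])
    constructor
    · constructor <;> simp [Program.eval, h.hM, h.hN, h.hK, h.hZero, h.hOne, h.hStride,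
        h.hDissat, h.hIn]
    · constructor
      · simp [Program.eval, h.hState, flat]
      · simp [Program.eval, h.hLayer]
      · simpa [Program.eval, flat] using h.hVal
      · simpa [Program.eval, flat] using h.hPred
      · simpa [Program.eval, flat] using h.hCand
      · simpa [Program.eval] using h.hBest
    · simp [Program.eval, h.hVoter]
    · simp [Program.eval, h.hVotes]
    · simp [Program.eval, h.hT]
    · simpa [Program.eval] using h.hCost
    · simp [Program.eval]
    · simp [Program.eval, h.hState, h.hZero, argminBelow, flat]
    · intro h0; simp [Program.eval, h.hLayer, h.hK, h.hOne, hsw h0]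
    · intro h0
      simp [Program.eval, h.hLayer, h.hK, h.hOne, hsw h0, hsv h0]
  intro s1 h1
  refine Program.Runs.seq (Program.Runs.whileLT (StateInv ℓ m n K base A X w i t) ?_ ?_ h1) ?_
  · intro c hc s h
    exact ⟨by rwa [h.hCandidate, h.hM], h.runs_processState ht hc⟩
  · intro s h
    rw [h.hCandidate, h.hM]; exact lt_irrefl _
  intro s2 h2
  refine Program.LoopFree.runs (by simp [Program.LoopFree]) ?_
  have hf : flat m K (i + 1) t m = ((i + 1) * K + (t + 1)) * m := by
    rw [flat, ← add_assoc, Nat.succ_mul _ m]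
  constructor
  · constructor <;> simp [Program.eval, h2.hM, h2.hN, h2.hK, h2.hZero, h2.hOne, h2.hStride,
      h2.hDissat, h2.hIn]
  · constructor
    · simp [Program.eval, h2.hState, hf]
    · simp [Program.eval, h2.hLayer, h2.hOne, add_assoc]
    · simpa [Program.eval, hf] using h2.hVal
    · simpa [Program.eval, hf] using h2.hPred
    · simpa [Program.eval, hf] using h2.hCand
    · intro x hx
      simp only [Program.eval, Mem.arr_setReg, Mem.arr_setArr, if_true, Function.update_apply,
        h2.hLayer, h2.hBestState]
      split_ifs with hx'
      · rw [hx', bestTable_flat _ _ _ ht]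
      · exact h2.hBest x (by omega)
  · simp [Program.eval, h2.hVoter]
  · simp [Program.eval, h2.hVotes]
  · simp [Program.eval, h2.hT, h2.hOne]
  · simpa [Program.eval] using h2.hCost

/-- Writing A r into the cell of the candidate at position r inverts the preference order on the
fly, so positions need not be searched for. -/
theorem VoterInv.runs_readVote {i : ℕ} (hw : ∀ r < m, w i (X (base + i * m + r)) = A r)
    {s : Mem} (h : VoterInv ℓ m n K base A X w i s) :
    Program.readVote.Runs s (6 * m + 2) (RankInv ℓ m n K base A X w i m) := by
  refine Program.Runs.mono (B := 1 + (m * (5 + 1) + 1)) ?_ (by omega) fun _ h => h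
  refine Program.Runs.seq (Q := RankInv ℓ m n K base A X w i 0) ?_ ?_
  · refine Program.LoopFree.runs (by trivial) ?_
    exact
    { hM := by simp [Program.eval, h.hM]
      hN := by simp [Program.eval, h.hN]
      hK := by simp [Program.eval, h.hK]
      hZero := by simp [Program.eval, h.hZero]
      hOne := by simp [Program.eval, h.hOne]
      hStride := by simp [Program.eval, h.hStride]
      hDissat := by simp [Program.eval, h.hDissat]
      hIn := by simp [Program.eval, h.hIn]
      hState := by simp [Program.eval, h.hState]
      hLayer := by simp [Program.eval, h.hLayer]
      hVal := h.hVal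
      hPred := h.hPred
      hCand := h.hCand
      hBest := h.hBest
      hVoter := by simp [Program.eval, h.hVoter]
      hVotes := by simp [Program.eval, h.hVotes]
      hRank := by simp [Program.eval]
      hCost := by simp }
  intro s1 h1
  refine Program.Runs.whileLT (RankInv ℓ m n K base A X w i) ?_ ?_ h1
  · intro r hr s h
    refine ⟨by rwa [h.hRank, h.hM], Program.LoopFree.runs (by simp [Program.LoopFree]) ?_⟩
    exact
    { hM := by simp [Program.eval, h.hM]
      hN := by simp [Program.eval, h.hN]
      hK := by simp [Program.eval, h.hK]
      hZero := by simp [Program.eval, h.hZero]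
      hOne := by simp [Program.eval, h.hOne]
      hStride := by simp [Program.eval, h.hStride]
      hDissat := by simp [Program.eval, h.hDissat]
      hIn := by simp [Program.eval, h.hIn]
      hState := by simp [Program.eval, h.hState]
      hLayer := by simp [Program.eval, h.hLayer]
      hVal := by simpa [Program.eval] using h.hVal
      hPred := by simpa [Program.eval] using h.hPred
      hCand := by simpa [Program.eval] using h.hCand
      hBest := by simpa [Program.eval] using h.hBest
      hVoter := by simp [Program.eval, h.hVoter]
      hVotes := by simp [Program.eval, h.hVotes, h.hOne, add_assoc]
      hRank := by simp [Program.eval, h.hRank, h.hOne]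
      hCost := by
        intro x hx
        simp only [Program.eval, Mem.arr_setReg, Mem.arr_setArr, Mem.reg_setReg, if_true]
        simp +decide only [if_false, Function.update_apply, h.hVotes, h.hRank, h.hDissat,
          h.hIn]
        split_ifs with hx'
        · rw [hx', hw r hr]
        · refine h.hCost x ((Nat.lt_succ_iff_lt_or_eq.1 hx).resolve_right ?_)
          rintro rfl
          exact hx' rfl }
  · intro s h
    rw [h.hRank, h.hM]; exact lt_irrefl _

theorem VoterInv.runs_processVoter (hm : 0 < m) {i : ℕ} (hw : ∀ r < m, w i (X (base + i * m + r)) = A r)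
    (hX : ∀ c < m, ∃ r < m, X (base + i * m + r) = c)
    {s : Mem} (h : VoterInv ℓ m n K base A X w i s) :
    (Program.processVoter ℓ).Runs s (K * (22 * m + 11) + 6 * m + 5)
      (VoterInv ℓ m n K base A X w (i + 1)) := by
  refine Program.Runs.mono (B := 6 * m + 2 + (1 + ((K * (22 * m + 11) + 1) + 1))) ?_
    (by omega) fun _ h => h
  refine (h.runs_readVote hw).seq ?_
  intro s h
  refine Program.Runs.seq (Q := LayerInv ℓ m n K base A X w i 0) ?_ ?_
  · refine Program.LoopFree.runs (by trivial) ?_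
    exact
    { hM := by simp [Program.eval, h.hM]
      hN := by simp [Program.eval, h.hN]
      hK := by simp [Program.eval, h.hK]
      hZero := by simp [Program.eval, h.hZero]
      hOne := by simp [Program.eval, h.hOne]
      hStride := by simp [Program.eval, h.hStride]
      hDissat := by simp [Program.eval, h.hDissat]
      hIn := by simp [Program.eval, h.hIn]
      hState := by simp [Program.eval, h.hState]
      hLayer := by simp [Program.eval, h.hLayer]
      hVal := h.hVal
      hPred := h.hPred
      hCand := h.hCand
      hBest := h.hBest
      hVoter := by simp [Program.eval, h.hVoter]
      hVotes := by simp [Program.eval, h.hVotes, Nat.succ_mul, add_assoc]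
      hT := by simp [Program.eval]
      -- Every candidate occurs in the vote, so the costs of all candidates have been written.
      hCost := by
        intro c hc
        obtain ⟨r, hr, rfl⟩ := hX c hc
        exact h.hCost r hr }
  intro s1 h1
  refine Program.Runs.seq (Program.Runs.whileLT (LayerInv ℓ m n K base A X w i) ?_ ?_ h1) ?_
  · intro t ht s h
    exact ⟨by rwa [h.hT, h.hK], h.runs_processLayer hm ht⟩
  · intro s h
    rw [h.hT, h.hK]; exact lt_irrefl _
  clear! s s1
  intro s h
  have hK : (i + 1) * K + K = (i + 1 + 1) * K := (Nat.succ_mul _ _).symm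
  refine Program.LoopFree.runs (by trivial) ?_
  exact
  { hM := by simp [Program.eval, h.hM]
    hN := by simp [Program.eval, h.hN]
    hK := by simp [Program.eval, h.hK]
    hZero := by simp [Program.eval, h.hZero]
    hOne := by simp [Program.eval, h.hOne]
    hStride := by simp [Program.eval, h.hStride]
    hDissat := by simp [Program.eval, h.hDissat]
    hIn := by simp [Program.eval, h.hIn]
    hState := by simp [Program.eval, h.hState, hK]
    hLayer := by simp [Program.eval, h.hLayer, hK]
    hVal := by rw [← hK]; exact h.hVal
    hPred := by rw [← hK]; exact h.hPred
    hCand := by rw [← hK]; exact h.hCand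
    hBest := by rw [← hK]; exact h.hBest
    hVoter := by simp [Program.eval, h.hVoter, h.hOne]
    hVotes := by simp [Program.eval, h.hVotes] }

/-! ### Initialization, read-out, and running time of the core -/

/-- The memory before the core program is executed. -/
structure CoreInput (m n k base : ℕ) (A X : ℕ → ℕ) (s : Mem) : Prop where
  hM : s.reg rM = m
  hN : s.reg rN = n
  hK : s.reg rK = k
  hVotes : s.reg rVotes = base
  hDissat : s.arr aDissat = A
  hIn : s.arr aIn = X
  hVal : ∀ x, s.arr aVal x = 0

theorem argminBelow_const (b c : ℕ) : argminBelow (fun _ => b) c = 0 := by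
  induction c with
  | zero => rfl
  | succ c ih => rw [argminBelow, if_neg (lt_irrefl _), ih]

theorem dpTable_zero (t : ℕ) : dpTable ℓ m w 0 t = fun _ => 0 := by
  funext c; simp [dpTable]

/-- Row 0, before any voter, has value zero everywhere, which the untouched memory already holds.
Only its best states have to be written: the first minimizer of a constant is candidate 0, at
address t * m. Repeated addition of m also yields the stride K * m. -/
theorem CoreInput.runs_initTables {k : ℕ} {s : Mem} (h : CoreInput m n k base A X s) :
    Program.initTables.Runs s (4 * min k n + 10)
      (VoterInv ℓ m n (min k n) base A X w 0) := by
  refine Program.Runs.mono (B := 8 + ((min k n * (3 + 1) + 1) + 1)) ?_ (by omega) fun _ h => h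
  have hval : ∀ x < min k n * m, valTable ℓ m (min k n) w x = 0 := by
    intro x hx
    have : x / m / min k n = 0 := by
      rw [Nat.div_div_eq_div_mul, Nat.mul_comm, Nat.div_eq_of_lt hx]
    rw [valTable, this, dpTable_zero]
  let I : ℕ → Mem → Prop := fun j s => s.reg rM = m ∧ s.reg rN = n ∧ s.reg rK = min k n ∧
    s.reg rZero = 0 ∧ s.reg rOne = 1 ∧ s.reg rVotes = base ∧ s.reg rVoter = 0 ∧
    s.arr aDissat = A ∧ s.arr aIn = X ∧ (∀ x, s.arr aVal x = 0) ∧ s.reg rLayer = j ∧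
    s.reg rState = j * m ∧ ∀ x < j, s.arr aBest x = x * m
  refine Program.Runs.seq (Q := I 0) ?_ ?_
  · refine Program.LoopFree.runs (by simp [Program.LoopFree]) ?_
    have hk : min k n = if n < k then n else k := by split_ifs <;> omega
    simp only [I, hk, Program.eval, Mem.reg_setReg, h.hN, h.hK]
    simp +decide only [if_true, if_false]
    split_ifs <;> simp [h.hM, h.hN, h.hK, h.hVotes, h.hDissat, h.hIn, h.hVal]
  intro s1 h1
  refine Program.Runs.seq (Program.Runs.whileLT I ?_ ?_ h1) ?_
  · rintro j hj s ⟨h1, h2, h3, h4, h5, h6, h7, h8, h9, h10, h11, h12, h13⟩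
    refine ⟨by rwa [h11, h3], Program.LoopFree.runs (by simp [Program.LoopFree]) ?_⟩
    refine ⟨?_, ?_, ?_, ?_, ?_, ?_, ?_, ?_, ?_, ?_, ?_, ?_, ?_⟩
    all_goals try simp [Program.eval, h1, h2, h3, h4, h5, h6, h7, h8, h9, h10, h11, h12,
      Nat.succ_mul]
    intro x hx
    rw [Function.update_apply]
    split_ifs with hx'
    · rw [hx']
    · exact h13 x (by omega)
  · rintro s ⟨h1, h2, h3, h4, h5, h6, h7, h8, h9, h10, h11, h12, h13⟩
    rw [h11, h3]; exact lt_irrefl _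
  · rintro s ⟨h1, h2, h3, h4, h5, h6, h7, h8, h9, h10, h11, h12, h13⟩
    refine Program.LoopFree.runs (by trivial) ?_
    exact
    { hM := by simp [Program.eval, h1]
      hN := by simp [Program.eval, h2]
      hK := by simp [Program.eval, h3]
      hZero := by simp [Program.eval, h4]
      hOne := by simp [Program.eval, h5]
      hStride := by simp [Program.eval, h12, h4]
      hDissat := by simp [Program.eval, h8]
      hIn := by simp [Program.eval, h9]
      hState := by simp [Program.eval, h12]
      hLayer := by simp [Program.eval, h11]
      hVal := by
        intro x hx
        rw [zero_add, one_mul] at hx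
        simp [Program.eval, h10, hval x hx]
      hPred := fun x hx hx' => by rw [zero_add, one_mul] at hx; omega
      hCand := fun x hx hx' => by rw [zero_add, one_mul] at hx; omega
      hBest := by
        intro x hx
        rw [zero_add, one_mul] at hx
        simp [Program.eval, h13 x hx, bestTable, Nat.div_eq_of_lt hx, dpTable_zero,
          argminBelow_const]
      hVoter := by simp [Program.eval, h7]
      hVotes := by simp [Program.eval, h6] }

theorem VoterInv.runs_traceBack (hm : 0 < m) (hK : 0 < K) {s : Mem}
    (h : VoterInv ℓ m n K base A X w n s) :
    Program.traceBack.Runs s (5 * n + 4) fun s' => s'.reg 1 = n ∧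
      ∀ x < n, s'.arr aOut x =
        dpTrace ℓ m w n (K - 1) (argminBelow (dpTable ℓ m w n (K - 1)) m) x := by
  refine Program.Runs.mono (B := 2 + ((n * (4 + 1) + 1) + 1)) ?_ (by omega) fun _ h => h
  set g := dpTrace ℓ m w n (K - 1) (argminBelow (dpTable ℓ m w n (K - 1)) m) with hg
  -- After j rounds the last j outputs are written, and on the earlier voters g is the trace of the
  -- current state, which lies in row n - j. Only rows above row 0 carry predecessors and
  -- candidates.
  let I : ℕ → Mem → Prop := fun j s => s.reg rN = n ∧ s.reg rZero = 0 ∧ s.reg rOne = 1 ∧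
    s.reg rVoter = n - j ∧
    (∀ x < (n + 1) * K * m, K * m ≤ x →
      s.arr aPred x = predTable ℓ m K w x ∧ s.arr aCand x = x % m) ∧
    (∀ x, n - j ≤ x → x < n → s.arr aOut x = g x) ∧
    ∃ t < K, ∃ c < m, s.reg rState = flat m K (n - j) t c ∧
      ∀ x < n - j, g x = dpTrace ℓ m w (n - j) t c x
  refine Program.Runs.seq (Q := I 0) ?_ ?_
  · refine Program.LoopFree.runs (by simp [Program.LoopFree]) ?_
    have hq : (n + 1) * K - 1 = n * K + (K - 1) := by rw [Nat.succ_mul]; omega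
    refine ⟨?_, ?_, ?_, ?_, ?_, ?_, K - 1, by omega, _, argminBelow_lt _ hm, ?_, fun x _ => rfl⟩
    · simp [Program.eval, h.hN]
    · simp [Program.eval, h.hZero]
    · simp [Program.eval, h.hOne]
    · simp [Program.eval, h.hVoter]
    · intro x hx hx'
      exact ⟨h.hPred x hx hx', h.hCand x hx hx'⟩
    · intro x hx hx'; omega
    · simp only [Program.eval, Mem.arr_setReg, Mem.reg_setReg]
      simp +decide only [if_true, if_false, h.hLayer, h.hOne, hq]
      rw [h.hBest _ (by rw [Nat.succ_mul]; omega), bestTable_flat _ _ _ (by omega)]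
      rfl
  intro s1 h1
  refine Program.Runs.seq (Program.Runs.whileLT I ?_ ?_ h1) ?_
  · rintro j hj s ⟨h1, h2, h3, h4, h5, h6, t, ht, c, hc, h7, h8⟩
    refine ⟨by rw [h2, h4]; omega, Program.LoopFree.runs (by simp [Program.LoopFree]) ?_⟩
    obtain ⟨i, hi⟩ : ∃ i, n - j = i + 1 := ⟨n - j - 1, by omega⟩
    have hi' : n - (j + 1) = i := by omega
    rw [hi] at h4 h6 h7 h8
    have hlow : K * m ≤ flat m K (i + 1) t c := by
      rw [flat, Nat.add_mul, Nat.succ_mul, Nat.add_mul]; omega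
    have hhigh : flat m K (i + 1) t c < (n + 1) * K * m :=
      calc flat m K (i + 1) t c < flat m K (i + 1 + 1) 0 0 := flat_lt_flat _ ht hc
        _ = (i + 1 + 1) * K * m := by simp [flat]
        _ ≤ _ := Nat.mul_le_mul_right _ (Nat.mul_le_mul_right _ (by omega))
    obtain ⟨h9, h10⟩ := h5 _ hhigh hlow
    rw [predTable_flat _ _ _ ht hc] at h9
    rw [flat_mod _ _ hc] at h10
    simp only [I, hi']
    refine ⟨?_, ?_, ?_, ?_, ?_, ?_, _, (dpPred_fst_le m (dpTable ℓ m w i) t c).trans_lt ht, _,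
      dpPred_snd_lt (dpTable ℓ m w i) (t := t) hc, ?_, fun x hx => ?_⟩
    · simp [Program.eval, h1]
    · simp [Program.eval, h2]
    · simp [Program.eval, h3]
    · simp [Program.eval, h3, h4]
    · simpa [Program.eval] using h5
    · intro x hx hx'
      simp only [Program.eval, Mem.arr_setReg, Mem.reg_setReg, Mem.arr_setArr]
      simp +decide only [if_true, if_false, Function.update_apply, h3, h4, h7, h10,
        Nat.add_sub_cancel]
      split_ifs with hx''
      · rw [hx'', h8 i (by omega), dpTrace, Function.update_self]
      · exact h6 x (by omega) hx'
    · simp [Program.eval, h7, h9]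
    · rw [h8 x (by omega), dpTrace, Function.update_of_ne (by omega)]
  · rintro s ⟨h1, h2, h3, h4, -⟩
    rw [h2, h4]; omega
  · rintro s ⟨h1, h2, h3, h4, h5, h6, -⟩
    refine Program.LoopFree.runs (by trivial) ⟨?_, ?_⟩
    · simp [Program.eval, h1, h2]
    · intro x hx
      exact h6 x (by omega) hx

theorem CoreInput.runs_core {k : ℕ} (hm : 0 < m) (hn : 0 < n) (hk : 0 < k)
    (hw : ∀ i < n, ∀ r < m, w i (X (base + i * m + r)) = A r)
    (hX : ∀ i < n, ∀ c < m, ∃ r < m, X (base + i * m + r) = c)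
    {s : Mem} (h : CoreInput m n k base A X s) :
    (Program.core ℓ).Runs s (70 * (m * n * min k n)) fun s' => s'.reg 1 = n ∧
      ∀ x < n, s'.arr aOut x = dpTrace ℓ m w n (min k n - 1)
        (argminBelow (dpTable ℓ m w n (min k n - 1)) m) x := by
  have hK : 0 < min k n := lt_min hk hn
  refine Program.Runs.mono (B := 4 * min k n + 10 +
    ((n * (min k n * (22 * m + 11) + 6 * m + 5 + 1) + 1) + (5 * n + 4))) ?_ ?_ fun _ h => h
  · refine (h.runs_initTables (ℓ := ℓ) (w := w)).seq ?_
    intro s1 h1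
    refine Program.Runs.seq
      (Program.Runs.whileLT (VoterInv ℓ m n (min k n) base A X w) ?_ ?_ h1) ?_
    · intro i hi s h
      exact ⟨by rwa [h.hVoter, h.hN], h.runs_processVoter hm (hw i hi) (hX i hi)⟩
    · intro s h
      rw [h.hVoter, h.hN]; exact lt_irrefl _
    · intro s h
      exact h.runs_traceBack hm hK
  -- Every term is at most its coefficient times m * n * K, which is at least 1; the coefficients
  -- add up to 69.
  · generalize min k n = K at hK ⊢
    have e1 : K ≤ m * n * K := Nat.le_mul_of_pos_left _ (Nat.mul_pos hm hn)
    have e2 : n * K ≤ m * n * K := Nat.mul_le_mul_right _ (Nat.le_mul_of_pos_left _ hm)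
    have e3 : m * n ≤ m * n * K := Nat.le_mul_of_pos_right _ hK
    have e4 : n ≤ n * K := Nat.le_mul_of_pos_right _ hK
    have e5 : n * (K * (22 * m + 11) + 6 * m + 5 + 1) =
      22 * (m * n * K) + 11 * (n * K) + 6 * (m * n) + 6 * n := by ring
    rw [e5]
    omega

end

/-! ### Running a program inside another one -/

notation "rOffset" => 22
notation "rMax" => 23
notation "rAddr" => 24

/-- The program `P` with its registers and arrays renamed, and all array addresses shifted by
`reg rOffset`. The largest address written to is recorded in `reg rMax`. -/
def Program.relocate : Program → Program
  | .skip => .skip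
  | .const x c => .const (x + 32) c
  | .add x y z => .add (x + 32) (y + 32) (z + 32)
  | .sub x y z => .sub (x + 32) (y + 32) (z + 32)
  | .load x a y => .seq (.add rAddr rOffset (y + 32)) (.load (x + 32) (a + 8) rAddr)
  | .store a x y =>
    .seq (.add rAddr rOffset (x + 32)) <|
    .seq (.ifLT rMax rAddr (.add rMax rAddr rZero) .skip) (.store (a + 8) rAddr (y + 32))
  | .seq P Q => .seq P.relocate Q.relocate
  | .ifLT x y P Q => .ifLT (x + 32) (y + 32) P.relocate Q.relocate
  | .whileLT x y P => .whileLT (x + 32) (y + 32) P.relocate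

/-- `s'` represents the memory `s` of a relocated program. -/
structure Represents (s s' : Mem) : Prop where
  hReg : ∀ x, s'.reg (x + 32) = s.reg x
  hArr : ∀ a x, s'.arr (a + 8) (s'.reg rOffset + x) = s.arr a x
  hMax : ∀ a x, s'.reg rMax < x → s'.arr (a + 8) x = 0
  hZero : s'.reg rZero = 0

/-- `s'` and `s` agree outside the memory used by relocated programs. -/
def SameHost (s s' : Mem) : Prop :=
  (∀ x < 32, x ≠ rMax → x ≠ rAddr → s'.reg x = s.reg x) ∧ ∀ a < 8, s'.arr a = s.arr a

theorem SameHost.trans {s s' s'' : Mem} (h : SameHost s s') (h' : SameHost s' s'') :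
    SameHost s s'' :=
  ⟨fun x hx h1 h2 => (h'.1 x hx h1 h2).trans (h.1 x hx h1 h2),
    fun a ha => (h'.2 a ha).trans (h.2 a ha)⟩

theorem SameHost.setReg (s : Mem) {x : ℕ} (hx : 32 ≤ x) (v : ℕ) : SameHost s (s.setReg x v) :=
  ⟨fun y hy _ _ => by rw [Mem.reg_setReg, if_neg (by omega)], fun _ _ => rfl⟩

theorem Represents.setReg {s s' : Mem} (h : Represents s s') (x v : ℕ) :
    Represents (s.setReg x v) (s'.setReg (x + 32) v) where
  hReg y := by simp [h.hReg]
  hArr := by simpa using h.hArr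
  hMax := by simpa using h.hMax
  hZero := by simp [h.hZero]

/-- Simulation instruction by instruction. The factor 5 is the size bound for a store, which must
also compute the address and update the record of the largest one; that record keeps the memory
above it known to be zero. -/
theorem Represents.exec_relocate {P : Program} {s s₁ : Mem} {t : ℕ} (hP : Exec P s s₁ t) :
    ∀ s', Represents s s' → ∃ s₁' t', Exec P.relocate s' s₁' t' ∧ t' ≤ 5 * t ∧
      Represents s₁ s₁' ∧ SameHost s' s₁' := by
  induction hP with
  | skip s => exact fun s' h => ⟨s', 1, .skip s', by omega, h, fun _ _ _ _ => rfl, fun _ _ => rfl⟩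
  | const s x c =>
    exact fun s' h => ⟨_, 1, .const s' _ c, by omega, h.setReg x c, .setReg s' (by omega) c⟩
  | add s x y z =>
    intro s' h
    refine ⟨_, 1, .add s' _ _ _, by omega, ?_, .setReg s' (by omega) _⟩
    rw [h.hReg, h.hReg]
    exact h.setReg x _
  | sub s x y z =>
    intro s' h
    refine ⟨_, 1, .sub s' _ _ _, by omega, ?_, .setReg s' (by omega) _⟩
    rw [h.hReg, h.hReg]
    exact h.setReg x _
  | load s x a y =>
    intro s' h
    refine ⟨_, 2, (Exec.add s' _ _ _).seq (.load _ _ _ _), by omega, ?_, ?_⟩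
    · constructor
      · intro z; simp [h.hReg, h.hArr]
      · simpa using h.hArr
      · simpa using h.hMax
      · simp [h.hZero]
    · refine ⟨fun z hz h1 h2 => ?_, fun _ _ => rfl⟩
      have : z ≠ x + 32 := by omega
      simp [this, h2]
  | store s a x y =>
    intro s' h
    obtain ⟨t, ht, hE⟩ := Program.LoopFree.exec (P := (Program.store a x y).relocate)
      (by simp [Program.relocate, Program.LoopFree]) s'
    refine ⟨_, t, hE, ht.trans (by simp [Program.relocate, Program.size]), ?_⟩
    obtain ⟨s₁, hs₁, hreg, hmax, harr⟩ : ∃ s₁, (Program.store a x y).relocate.eval s' = s₁ ∧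
        (∀ z, z ≠ rMax → z ≠ rAddr → s₁.reg z = s'.reg z) ∧
        s₁.reg rMax = max (s'.reg rMax) (s'.reg rOffset + s.reg x) ∧
        s₁.arr = (s'.setArr (a + 8) (s'.reg rOffset + s.reg x) (s.reg y)).arr := by
      refine ⟨_, rfl, ?_⟩
      simp only [Program.relocate, Program.eval, Mem.reg_setReg]
      simp +decide only [if_true, if_false, h.hReg, h.hZero, add_zero]
      split_ifs with h1
      · refine ⟨fun z h2 h3 => by simp [h2, h3], by simp [max_eq_right h1.le], ?_⟩
        funext b
        simp [h.hReg]
      · refine ⟨fun z h2 h3 => by simp [h3], by simp [max_eq_left (not_lt.1 h1)], ?_⟩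
        funext b
        simp [h.hReg]
    rw [hs₁]
    refine ⟨⟨?_, ?_, ?_, ?_⟩, fun z _ h1 h2 => hreg z h1 h2, fun b hb => ?_⟩
    · intro z
      rw [hreg _ (by omega) (by omega), h.hReg]
      rfl
    · intro b z
      rw [hreg _ (by decide) (by decide), harr, Mem.arr_setArr, Mem.arr_setArr]
      by_cases hb : b = a
      · subst hb
        simp only [if_true, Function.update_apply, Nat.add_left_cancel_iff, h.hArr]
      · simp [hb, h.hArr]
    · intro b z hz
      rw [hmax, max_lt_iff] at hz
      rw [harr, Mem.arr_setArr]
      by_cases hb : b = a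
      · subst hb
        rw [if_pos rfl, Function.update_of_ne hz.2.ne', h.hMax _ _ hz.1]
      · simp [hb, h.hMax _ _ hz.1]
    · rw [hreg _ (by decide) (by decide), h.hZero]
    · have : b ≠ a + 8 := by omega
      rw [harr, Mem.arr_setArr, if_neg this]
  | seq _ _ ihP ihQ =>
    intro s' h
    obtain ⟨s₁, t₁, h1, h2, h3, h4⟩ := ihP s' h
    obtain ⟨s₂, t₂, h5, h6, h7, h8⟩ := ihQ s₁ h3
    exact ⟨s₂, _, h1.seq h5, by omega, h7, h4.trans h8⟩
  | ifTrue hlt _ ih =>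
    intro s' h
    obtain ⟨s₁, t₁, h1, h2, h3, h4⟩ := ih s' h
    exact ⟨s₁, _, .ifTrue (by rwa [h.hReg, h.hReg]) h1, by omega, h3, h4⟩
  | ifFalse hlt _ ih =>
    intro s' h
    obtain ⟨s₁, t₁, h1, h2, h3, h4⟩ := ih s' h
    exact ⟨s₁, _, .ifFalse (by rwa [h.hReg, h.hReg]) h1, by omega, h3, h4⟩
  | whileTrue hlt _ _ ihP ihQ =>
    intro s' h
    obtain ⟨s₁, t₁, h1, h2, h3, h4⟩ := ihP s' h
    obtain ⟨s₂, t₂, h5, h6, h7, h8⟩ := ihQ s₁ h3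
    exact ⟨s₂, _, .whileTrue (by rwa [h.hReg, h.hReg]) h1 h5, by omega, h7, h4.trans h8⟩
  | whileFalse hlt =>
    exact fun s' h => ⟨s', 1, .whileFalse (by rwa [h.hReg, h.hReg]), by omega, h,
      fun _ _ _ _ => rfl, fun _ _ => rfl⟩

/-- A positive strict bound for the registers that the program writes to. -/
def Program.regBound : Program → ℕ
  | .skip => 1
  | .const x _ => x + 1
  | .add x _ _ => x + 1
  | .sub x _ _ => x + 1
  | .load x _ _ => x + 1
  | .store _ _ _ => 1
  | .seq P Q => max P.regBound Q.regBound
  | .ifLT _ _ P Q => max P.regBound Q.regBound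
  | .whileLT _ _ P => P.regBound

theorem Program.regBound_pos (P : Program) : 0 < P.regBound := by
  induction P <;> simp_all [regBound]

/-- Only finitely many registers can become dirty, so a fixed number of instructions resets them
between two runs. -/
theorem Exec.reg_eq_of_regBound_le {P : Program} {s s' : Mem} {t : ℕ} (h : Exec P s s' t) :
    ∀ x, P.regBound ≤ x → s'.reg x = s.reg x := by
  induction h with
  | skip s => exact fun _ _ => rfl
  | store => exact fun _ _ => rfl
  | const | add | sub | load =>
    intro x hx
    simp only [Program.regBound] at hx
    rw [Mem.reg_setReg, if_neg (by omega)]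
  | seq _ _ ihP ihQ =>
    intro x hx
    simp only [Program.regBound, max_le_iff] at hx
    rw [ihQ x hx.2, ihP x hx.1]
  | ifTrue _ _ ih =>
    intro x hx
    simp only [Program.regBound, max_le_iff] at hx
    exact ih x hx.1
  | ifFalse _ _ ih =>
    intro x hx
    simp only [Program.regBound, max_le_iff] at hx
    exact ih x hx.2
  | whileTrue _ _ _ ihP ihQ =>
    intro x hx
    rw [ihQ x hx, ihP x hx]
  | whileFalse => exact fun _ _ => rfl

/-- Reset the first `b` registers of relocated programs. -/
def Program.clear : ℕ → Program
  | 0 => .skip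
  | b + 1 => .seq (.clear b) (.const (b + 32) 0)

theorem Program.loopFree_clear (b : ℕ) : (Program.clear b).LoopFree := by
  induction b with
  | zero => trivial
  | succ b ih => exact ⟨ih, trivial⟩

theorem Program.size_clear (b : ℕ) : (Program.clear b).size = b + 1 := by
  induction b with
  | zero => rfl
  | succ b ih => rw [clear, size, ih]; rfl

theorem Program.arr_eval_clear (b : ℕ) (s : Mem) : ((Program.clear b).eval s).arr = s.arr := by
  induction b with
  | zero => rfl
  | succ b ih => rw [clear, eval, eval, Mem.arr_setReg, ih]

theorem Program.reg_eval_clear (b : ℕ) (s : Mem) (x : ℕ) :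
    ((Program.clear b).eval s).reg x = if 32 ≤ x ∧ x < b + 32 then 0 else s.reg x := by
  induction b with
  | zero => rw [if_neg (by omega)]; rfl
  | succ b ih =>
    rw [clear, eval, eval, Mem.reg_setReg, ih]
    split_ifs <;> first | rfl | omega

/-! ### Preparing the input of the core program -/

/-- Read the parameters `m`, `n`, `k`. -/
def Program.readParams : Program :=
  .seq (.const rZero 0) <|
  .seq (.const rOne 1) <|
  .seq (.const rRank 0) <|
  .seq (.const rMax 0) <|
  .seq (.const rVotes 0) <|
  .seq (.load rM aIn rVotes) <|
  .seq (.add rVotes rVotes rOne) <|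
  .seq (.load rN aIn rVotes) <|
  .seq (.add rVotes rVotes rOne) <|
  .seq (.load rK aIn rVotes) (.add rVotes rVotes rOne)

/-- Copy the values of the dissatisfaction function from the input. -/
def Program.copyDissat : Program :=
  .whileLT rRank rM <|
    .seq (.load rTmp aIn rVotes) <|
    .seq (.store aDissat rRank rTmp) <|
    .seq (.add rVotes rVotes rOne) (.add rRank rRank rOne)

/-- Prepare the relocated memory for the input `[m, r]`. -/
def Program.prepare (b : ℕ) : Program :=
  .seq (.clear b) <|
  .seq (.add rOffset rMax rOne) <|
  .seq (.add rMax rOffset rOne) <|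
  .seq (.store 8 rOffset rM) <|
  .seq (.store 8 rMax rRank) (.const 32 2)

/-- Tabulate the values of the dissatisfaction function, computed by `P`. -/
def Program.tabulate (P : Program) : Program :=
  .whileLT rRank rM <|
    .seq (.prepare P.regBound) <|
    .seq P.relocate <|
    .seq (.load rTmp 9 rOffset) <|
    .seq (.store aDissat rRank rTmp) (.add rRank rRank rOne)

/-- The memory while the table of the dissatisfaction function is filled in. -/
structure PrepInv (m n k base b : ℕ) (X a : ℕ → ℕ) (r : ℕ) (s : Mem) : Prop where
  hM : s.reg rM = m
  hN : s.reg rN = n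
  hK : s.reg rK = k
  hVotes : s.reg rVotes = base
  hZero : s.reg rZero = 0
  hOne : s.reg rOne = 1
  hRank : s.reg rRank = r
  hIn : s.arr aIn = X
  hVal : ∀ x, s.arr aVal x = 0
  hDissat : ∀ x < r, s.arr aDissat x = a x
  hMax : ∀ c x, s.reg rMax < x → s.arr (c + 8) x = 0
  hReg : ∀ x, b ≤ x → s.reg (x + 32) = 0

theorem PrepInv.coreInput {m n k base b r : ℕ} {X a : ℕ → ℕ} {s : Mem}
    (h : PrepInv m n k base b X a r s) : CoreInput m n k base (s.arr aDissat) X s :=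
  ⟨h.hM, h.hN, h.hK, h.hVotes, rfl, h.hIn, h.hVal⟩

theorem Program.runs_readParams (b : ℕ) (a : ℕ → ℕ) (m n k : ℕ) (l : List ℕ) :
    Program.readParams.Runs (Mem.init (m :: n :: k :: l)) 11
      (PrepInv m n k 3 b (fun i => (m :: n :: k :: l).getD i 0) a 0) := by
  refine (LoopFree.runs (by simp [readParams, LoopFree]) ?_).mono
    (by simp [readParams, size]) fun _ h => h
  constructor <;> simp [readParams, eval, Mem.init]

theorem Program.runs_copyDissat {m n k b : ℕ} {X a : ℕ → ℕ} (ha : ∀ r < m, X (3 + r) = a r)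
    {s : Mem} (h : PrepInv m n k 3 b X a 0 s) :
    Program.copyDissat.Runs s (m * 5 + 1) (PrepInv m n k (3 + m) b X a m) := by
  refine Runs.whileLT (B := 4) (fun r => PrepInv m n k (3 + r) b X a r) ?_ ?_ h
  · intro r hr s h
    refine ⟨by rwa [h.hRank, h.hM], LoopFree.runs (by simp [LoopFree]) ?_⟩
    exact
    { hM := by simp [eval, h.hM]
      hN := by simp [eval, h.hN]
      hK := by simp [eval, h.hK]
      hVotes := by simp [eval, h.hVotes, h.hOne, add_assoc]
      hZero := by simp [eval, h.hZero]
      hOne := by simp [eval, h.hOne]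
      hRank := by simp [eval, h.hRank, h.hOne]
      hIn := by simp [eval, h.hIn]
      hVal := by simpa [eval] using h.hVal
      hDissat := by
        intro x hx
        simp only [eval, Mem.arr_setReg, Mem.arr_setArr, Mem.reg_setReg]
        simp +decide only [if_true, if_false, Function.update_apply, h.hVotes, h.hRank, h.hIn]
        split_ifs with hx'
        · rw [hx', ha r hr]
        · exact h.hDissat x (by omega)
      hMax := by simpa [eval] using h.hMax
      hReg := by simpa [eval] using h.hReg }
  · intro s h
    rw [h.hRank, h.hM]; exact lt_irrefl _

/-- All addresses from the new offset on are unwritten, so after storing the two input words there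
the relocated memory looks exactly like an initial one. `SameHost` is stated after updating the
offset, the only other host register that changes. -/
theorem PrepInv.represents_prepare {m n k base b r : ℕ} {X a : ℕ → ℕ} {s : Mem}
    (h : PrepInv m n k base b X a r s) :
    Represents (Mem.init [m, r]) ((Program.prepare b).eval s) ∧
      SameHost (s.setReg rOffset (s.reg rMax + 1)) ((Program.prepare b).eval s) := by
  obtain ⟨s', hs', hreg, hoff, hmax, hlow, harr⟩ : ∃ s', (Program.prepare b).eval s = s' ∧
      (∀ x, s'.reg (x + 32) = (Mem.init [m, r]).reg x) ∧
      s'.reg rOffset = s.reg rMax + 1 ∧ s'.reg rMax = s.reg rMax + 1 + 1 ∧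
      (∀ x < 32, x ≠ rOffset → x ≠ rMax → s'.reg x = s.reg x) ∧
      s'.arr = ((s.setArr 8 (s.reg rMax + 1) m).setArr 8 (s.reg rMax + 1 + 1) r).arr := by
    refine ⟨_, rfl, fun x => ?_, ?_, ?_, fun x hx h1 h2 => ?_, ?_⟩
    · simp only [Program.prepare, Program.eval, Mem.reg_setReg, Mem.reg_setArr,
        Program.reg_eval_clear, Mem.init]
      have h1 : x + 32 ≠ 22 := by omega
      have h2 : x + 32 ≠ 23 := by omega
      simp only [h1, h2, if_false]
      by_cases hx : x = 0
      · simp [hx]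
      · have h3 : x + 32 ≠ 32 := by omega
        rw [if_neg h3, if_neg hx]
        split_ifs with h4
        · rfl
        · exact h.hReg x (by omega)
    · simp [Program.prepare, Program.eval, Program.reg_eval_clear, h.hOne]
    · simp [Program.prepare, Program.eval, Program.reg_eval_clear, h.hOne]
    · have h3 : x ≠ 32 := by omega
      have h4 : ¬ 32 ≤ x := by omega
      simp [Program.prepare, Program.eval, Program.reg_eval_clear, h1, h2, h3, h4]
    · funext c
      simp [Program.prepare, Program.eval, Program.reg_eval_clear, Program.arr_eval_clear, h.hOne,
        h.hM, h.hRank]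
  rw [hs']
  refine ⟨⟨hreg, fun c x => ?_, fun c x hx => ?_, ?_⟩, fun x hx h1 h2 => ?_, fun c hc => ?_⟩
  · have h1 := h.hMax c (s.reg rMax + 1 + x) (by omega)
    simp only [hoff, harr, Mem.arr_setArr]
    rcases Nat.eq_zero_or_pos c with rfl | hc
    · rcases x with _ | _ | x
      · simp [Mem.init]
      · simp [Mem.init]
      · have h2 : s.reg rMax + 1 + (x + 1 + 1) ≠ s.reg rMax + 1 + 1 := by omega
        have h3 : s.reg rMax + 1 + (x + 1 + 1) ≠ s.reg rMax + 1 := by omega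
        rw [if_pos rfl, if_pos trivial, Function.update_of_ne h2, Function.update_of_ne h3, h1]
        simp [Mem.init]
    · have h2 : c + 8 ≠ 8 := by omega
      rw [if_neg h2, if_neg h2, h1]
      simp [Mem.init, hc.ne']
  · have h1 := h.hMax c x (by omega)
    rw [hmax] at hx
    simp only [harr, Mem.arr_setArr]
    have h2 : x ≠ s.reg rMax + 1 + 1 := by omega
    have h3 : x ≠ s.reg rMax + 1 := by omega
    by_cases hc : c + 8 = 8
    · rw [if_pos hc, if_pos trivial, Function.update_of_ne h2, Function.update_of_ne h3, ← hc, h1]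
    · rw [if_neg hc, if_neg hc, h1]
  · rw [hlow 5 (by decide) (by decide) (by decide), h.hZero]
  · by_cases h3 : x = rOffset
    · rw [h3, hoff, Mem.reg_setReg, if_pos rfl]
    · rw [hlow x hx h3 h1, Mem.reg_setReg, if_neg h3]
  · have h3 : c ≠ 8 := by omega
    simp only [harr, Mem.arr_setArr, if_neg h3, Mem.arr_setReg]

/-- The cost per position is a reset of the registers of P, a simulated run at factor 5, and
constant overhead. The invariant that everything above the recorded maximum is zero survives each
run, so the next one finds fresh memory. -/
theorem Program.runs_tabulate {P : Program} {m n k base B : ℕ} {X a : ℕ → ℕ}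
    (ha : ∀ r < m, ∃ t ≤ B, P.Outputs [m, r] [a r] t) {s : Mem}
    (h : PrepInv m n k base P.regBound X a 0 s) :
    P.tabulate.Runs s (m * (P.regBound + 5 * B + 10) + 1)
      (PrepInv m n k base P.regBound X a m) := by
  refine (Runs.whileLT (B := P.regBound + 6 + (5 * B + 3))
    (fun r => PrepInv m n k base P.regBound X a r) ?_ ?_ h).mono
    (Nat.add_le_add_right (Nat.mul_le_mul_left _ (by omega)) _) fun _ h => h
  · intro r hr s h
    refine ⟨by rwa [h.hRank, h.hM], ?_⟩
    obtain ⟨t, ht, s₁, hE, hs₁⟩ := ha r hr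
    have hlen : s₁.reg 1 = 1 := by simpa [Mem.output] using congrArg List.length hs₁
    have hout : s₁.arr 1 0 = a r := by simpa [Mem.output, hlen] using hs₁
    have hbound := hE.reg_eq_of_regBound_le
    obtain ⟨hrep, hhost⟩ := h.represents_prepare
    obtain ⟨s₂, t₂, hE₂, ht₂, hrep₂, hhost₂⟩ := hrep.exec_relocate hE
    have hhost := hhost.trans hhost₂
    have hprep : (prepare P.regBound).Runs s (P.regBound + 6) fun s' =>
        s' = (prepare P.regBound).eval s := by
      refine (LoopFree.runs (Q := fun s' => s' = (prepare P.regBound).eval s) ?_ rfl).mono ?_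
        fun _ h => h
      · simp [prepare, LoopFree, loopFree_clear]
      · simp [prepare, size, size_clear]
    refine hprep.seq ?_
    rintro _ rfl
    refine Runs.seq (Q := fun s' => s' = s₂) ⟨s₂, t₂, hE₂, by omega, rfl⟩ ?_
    rintro _ rfl
    have hres := hrep₂.hArr 1 0
    rw [hout, add_zero] at hres
    refine LoopFree.runs (by simp [LoopFree]) ?_
    exact
    { hM := by simp [eval, hhost.1, h.hM]
      hN := by simp [eval, hhost.1, h.hN]
      hK := by simp [eval, hhost.1, h.hK]
      hVotes := by simp [eval, hhost.1, h.hVotes]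
      hZero := by simp [eval, hhost.1, h.hZero]
      hOne := by simp [eval, hhost.1, h.hOne]
      hRank := by simp [eval, hhost.1, h.hRank, h.hOne]
      hIn := by simp [eval, hhost.2, h.hIn]
      hVal := by simpa [eval, hhost.2] using h.hVal
      hDissat := by
        intro x hx
        simp only [eval, Mem.arr_setReg, Mem.arr_setArr, Mem.reg_setReg]
        simp +decide only [if_true, if_false, Function.update_apply, hhost.1, hhost.2,
          Mem.reg_setReg, Mem.arr_setReg, h.hRank]
        split_ifs with hx'
        · rw [hx', ← hres, hhost.1 22 (by decide) (by decide) (by decide)]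
          simp
        · exact h.hDissat x (by omega)
      hMax := by
        intro c x hx
        have hc : c + 8 ≠ 2 := by omega
        simp only [eval, Mem.arr_setReg, Mem.arr_setArr, Mem.reg_setReg, Mem.reg_setArr, hc,
          if_false] at hx ⊢
        simp +decide only [if_false] at hx
        exact hrep₂.hMax c x hx
      hReg := by
        intro x hx
        have h1 : x + 32 ≠ 12 := by omega
        have h2 : x + 32 ≠ 20 := by omega
        -- Register 0 of P starts with the input length instead of zero; positivity of `regBound`
        -- excludes it here.
        have h3 : x ≠ 0 := (P.regBound_pos.trans_le hx).ne'
        simp only [eval, Mem.reg_setReg, Mem.reg_setArr, h1, h2, h3, if_false, hrep₂.hReg,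
          hbound x hx, Mem.init] }
  · intro s h
    rw [h.hRank, h.hM]; exact lt_irrefl _

/-! ### Encodings -/

theorem getD_flatten {L : List (List ℕ)} {m : ℕ} (hL : ∀ l ∈ L, l.length = m) {i r : ℕ}
    (hi : i < L.length) (hr : r < m) : L.flatten.getD (i * m + r) 0 = (L[i]).getD r 0 := by
  induction L generalizing i with
  | nil => simp at hi
  | cons l L ih =>
    have hl : l.length = m := hL l (by simp)
    rw [List.flatten_cons]
    cases i with
    | zero =>
      rw [zero_mul, zero_add, List.getD_append _ _ _ _ (by omega)]
      rfl
    | succ i =>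
      have h1 : (i + 1) * m + r - l.length = i * m + r := by rw [Nat.succ_mul]; omega
      rw [List.getD_append_right _ _ _ _ (by rw [Nat.succ_mul]; omega), h1,
        ih (fun l hl => hL l (List.mem_cons_of_mem _ hl)) (by simpa using hi)]
      rfl

theorem Election.getD_encodeVotes (E : Election) {i r : ℕ} (hi : i < E.n) (hr : r < E.m) :
    E.encodeVotes.getD (i * E.m + r) 0 = E.vote ⟨i, hi⟩ ⟨r, hr⟩ := by
  rw [encodeVotes, getD_flatten ?_ (by simpa using hi) hr]
  · simp [List.getD, hr]
  · intro l hl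
    obtain ⟨j, rfl⟩ := (List.mem_ofFn' _ _).1 hl
    simp

theorem Election.length_encodeVotes (E : Election) : E.encodeVotes.length = E.n * E.m := by
  simp [encodeVotes, List.length_flatten, Function.comp_def, List.map_ofFn]

theorem length_le_bitLength (l : List ℕ) : l.length ≤ bitLength l := by
  induction l with
  | nil => exact Nat.zero_le _
  | cons a l ih =>
    simp only [bitLength, List.map_cons, List.sum_cons, List.length_cons] at ih ⊢
    omega

/-- Although m itself is written in binary, the votes occupy n * m words, each of at least one bit.
-/
theorem Election.m_le_bitLength (E : Election) (k : ℕ) : E.m ≤ bitLength (E.encode k) := by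
  refine le_trans ?_ (length_le_bitLength _)
  have := Nat.le_mul_of_pos_left E.m E.n_pos
  simp only [encode, List.length_append, E.length_encodeVotes]
  omega

theorem Election.n_le_bitLength (E : Election) (k : ℕ) : E.n ≤ bitLength (E.encode k) := by
  refine le_trans ?_ (length_le_bitLength _)
  have := Nat.le_mul_of_pos_right E.n E.m_pos
  simp only [encode, List.length_append, E.length_encodeVotes]
  omega

theorem output_eq_encodeAssignment {n m : ℕ} {s : Mem} (Φ : Fin n → Fin m) (hlen : s.reg 1 = n)
    (h : ∀ i : Fin n, s.arr 1 i = Φ i) : s.output = encodeAssignment Φ := by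
  apply List.ext_getElem
  · simp [Mem.output, encodeAssignment, hlen]
  · intro i h1 h2
    have hi : i < n := by simpa [Mem.output, hlen] using h1
    simpa [Mem.output, encodeAssignment] using h ⟨i, hi⟩

/-! ### The algorithm -/

/-- The core program computes an optimal assignment. -/
theorem CoreInput.runs_core_election {E : Election} {α : Fin E.m → ℕ} (ℓ : Aggregation) {k : ℕ}
    (hk : 0 < k) {base : ℕ} {A X : ℕ → ℕ} (hA : ∀ r : Fin E.m, A r = α r)
    (hX : ∀ (i : Fin E.n) (r : Fin E.m), X (base + i * E.m + r) = E.vote i r)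
    {s : Mem} (h : CoreInput E.m E.n k base A X s) :
    (Program.core ℓ).Runs s (70 * (E.m * E.n * min k E.n)) fun s' => s'.output =
      encodeAssignment fun i : Fin E.n =>
        (⟨E.solution α ℓ (min k E.n) i, E.solution_lt α ℓ _ _⟩ : Fin E.m) := by
  refine (h.runs_core (ℓ := ℓ) (w := E.cost α) E.m_pos E.n_pos hk ?_ ?_).mono le_rfl ?_
  · intro i hi r hr
    have h1 := hX ⟨i, hi⟩ ⟨r, hr⟩
    simp only at h1
    rw [h1, Election.cost, dif_pos ⟨hi, Fin.isLt _⟩]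
    have h2 := hA ⟨r, hr⟩
    simp only at h2
    rw [h2]
    congr 1
    exact (E.vote ⟨i, hi⟩).symm_apply_apply _
  · intro i hi c hc
    refine ⟨E.pos ⟨i, hi⟩ ⟨c, hc⟩, Fin.isLt _, ?_⟩
    have h1 := hX ⟨i, hi⟩ (E.pos ⟨i, hi⟩ ⟨c, hc⟩)
    simp only at h1
    rw [h1, Election.pos, Equiv.apply_symm_apply]
  · rintro s' ⟨h1, h2⟩
    exact output_eq_encodeAssignment _ h1 fun i => h2 i i.2

theorem Program.Runs.outputs {P : Program} {l o : List ℕ} {B : ℕ}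
    (h : P.Runs (Mem.init l) B fun s => s.output = o) : ∃ t ≤ B, P.Outputs l o t := by
  obtain ⟨s, t, hE, ht, hs⟩ := h
  exact ⟨t, ht, s, hE, hs⟩

theorem exists_outputs_encode (ℓ : Aggregation) {α : (m : ℕ) → Fin m → ℕ} {P : Program}
    {p : Polynomial ℕ} (hP : ∀ (m : ℕ) (i : Fin m), ∃ t ≤ p.eval m, P.Outputs [m, i] [α m i] t)
    (E : Election) {k : ℕ} (hk : 0 < k) :
    ∃ t ≤ 70 * (E.m * E.n * min k E.n) + (E.m * (P.regBound + 5 * p.eval E.m + 10) + 12),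
      (Program.seq (.seq .readParams P.tabulate) (.core ℓ)).Outputs (E.encode k)
        (encodeAssignment fun i : Fin E.n =>
          (⟨E.solution (α E.m) ℓ (min k E.n) i, E.solution_lt (α E.m) ℓ _ _⟩ : Fin E.m)) t := by
  let a : ℕ → ℕ := fun r => if h : r < E.m then α E.m ⟨r, h⟩ else 0
  have ha : ∀ r (hr : r < E.m), a r = α E.m ⟨r, hr⟩ := fun r hr => by simp [a, hr]
  apply Program.Runs.outputs
  refine Program.Runs.mono (B := (11 + (E.m * (P.regBound + 5 * p.eval E.m + 10) + 1)) +
    70 * (E.m * E.n * min k E.n)) ?_ (by omega) fun _ h => h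
  refine Program.Runs.seq (Program.Runs.seq
    (Program.runs_readParams P.regBound a E.m E.n k E.encodeVotes) fun s h =>
      Program.runs_tabulate (fun r hr => ?_) h) fun s h =>
        h.coreInput.runs_core_election ℓ hk (fun r => ?_) fun i r => ?_
  · rw [ha r hr]
    exact hP E.m ⟨r, hr⟩
  · rw [h.hDissat r r.2, ha _ r.2]
  · rw [← E.getD_encodeVotes i.2 r.2, add_assoc, Nat.add_comm 3]
    rfl

theorem exists_outputs_encodeWith (ℓ : Aggregation) (E : Election) (α : Fin E.m → ℕ) {k : ℕ}
    (hk : 0 < k) :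
    ∃ t ≤ 70 * (E.m * E.n * min k E.n) + (E.m * 5 + 12),
      (Program.seq (.seq .readParams .copyDissat) (.core ℓ)).Outputs (E.encodeWith α k)
        (encodeAssignment fun i : Fin E.n =>
          (⟨E.solution α ℓ (min k E.n) i, E.solution_lt α ℓ _ _⟩ : Fin E.m)) t := by
  let a : ℕ → ℕ := fun r => if h : r < E.m then α ⟨r, h⟩ else 0
  have ha : ∀ r (hr : r < E.m), a r = α ⟨r, hr⟩ := fun r hr => by simp [a, hr]
  apply Program.Runs.outputs
  refine Program.Runs.mono (B := (11 + (E.m * 5 + 1)) + 70 * (E.m * E.n * min k E.n)) ?_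
    (by omega) fun _ h => h
  refine Program.Runs.seq (Program.Runs.seq
    (Program.runs_readParams 0 a E.m E.n k (List.ofFn α ++ E.encodeVotes)) fun s h =>
      Program.runs_copyDissat (fun r hr => ?_) h) fun s h =>
        h.coreInput.runs_core_election ℓ hk (fun r => ?_) fun i r => ?_
  · rw [ha r hr, Nat.add_comm 3]
    simp only [List.getD_cons_succ]
    rw [List.getD_append _ _ _ _ (by simpa using hr)]
    simp [List.getD, hr]
  · rw [h.hDissat r r.2, ha _ r.2]
  · rw [show 3 + E.m + i * E.m + r = E.m + (i * E.m + r) + 3 by omega]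
    simp only [List.getD_cons_succ]
    rw [List.getD_append_right _ _ _ _ (by simp), List.length_ofFn, Nat.add_sub_cancel_left,
      E.getD_encodeVotes i.2 r.2]

theorem polynomial_eval_le_eval (p : Polynomial ℕ) {a b : ℕ} (h : a ≤ b) :
    p.eval a ≤ p.eval b := by
  rw [Polynomial.eval_eq_sum_range, Polynomial.eval_eq_sum_range]
  exact Finset.sum_le_sum fun i _ => Nat.mul_le_mul_left _ (Nat.pow_le_pow_left h i)

/-- The dynamic program is faster than required: min k n ≤ k ≤ n * k. -/
theorem mul_min_le {m n k : ℕ} (hn : 0 < n) : m * n * min k n ≤ m * n ^ 2 * k := by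
  rw [sq, ← mul_assoc, mul_assoc (m * n) n k]
  exact Nat.mul_le_mul_left _ ((min_le_left _ _).trans (Nat.le_mul_of_pos_left _ hn))

end SCElection

/-! ### The theorem: both algorithms and their time bounds -/

open SCElection

theorem theorem2 (ℓ : SCElection.Aggregation) :
    -- for every polynomial-time computable family: a polynomial-time algorithm, which moreover
    -- spends `O(m n² k)` steps apart from a time polynomial in `m` for evaluating the family
    (∀ α : (m : ℕ) → Fin m → ℕ, (∀ m, SCElection.IsDissatisfaction (α m)) →
      SCElection.PolyTimeFamily α →
      ∃ (P : SCElection.Program) (p q : Polynomial ℕ) (K : ℕ),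
        ∀ (E : SCElection.Election) (k : ℕ), E.SingleCrossing → 0 < k →
          ∃ (Φ : Fin E.n → Fin E.m) (t : ℕ),
            E.IsOptimalCC (α E.m) ℓ k Φ ∧
            P.Outputs (E.encode k) (SCElection.encodeAssignment Φ) t ∧
            t ≤ p.eval (SCElection.bitLength (E.encode k)) ∧
            t ≤ K * (E.m * E.n ^ 2 * k) + q.eval E.m) ∧
    -- when the `m` values of the dissatisfaction function are given: time `O(m n² k)`
    (∃ (Q : SCElection.Program) (K : ℕ),
      ∀ (E : SCElection.Election) (α : Fin E.m → ℕ) (k : ℕ),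
        E.SingleCrossing → SCElection.IsDissatisfaction α → 0 < k →
          ∃ (Φ : Fin E.n → Fin E.m) (t : ℕ),
            E.IsOptimalCC α ℓ k Φ ∧
            Q.Outputs (E.encodeWith α k) (SCElection.encodeAssignment Φ) t ∧
            t ≤ K * (E.m * E.n ^ 2 * k)) := by
  refine ⟨fun α hα ⟨P, p, hP⟩ => ?_, ?_⟩
  · set q : Polynomial ℕ := .X * (.C P.regBound + 5 * p + 10) + 12 with hq
    have hqe : ∀ x, q.eval x = x * (P.regBound + 5 * p.eval x + 10) + 12 := fun x => by
      simp [hq]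
    -- Each of m, n and min k n is at most the bit length, whence the cubic term; q accounts for
    -- reading the parameters and tabulating the family.
    refine ⟨.seq (.seq .readParams P.tabulate) (.core ℓ), 70 * .X ^ 3 + q, q, 70, fun E k hE hk => ?_⟩
    obtain ⟨t, ht, hout⟩ := exists_outputs_encode ℓ hP E hk
    rw [← hqe] at ht
    refine ⟨_, t, hE.isOptimalCC_solution (hα E.m) ℓ hk, hout, ?_, ?_⟩
    · have h1 := E.m_le_bitLength k
      have h2 := E.n_le_bitLength k
      have h3 := polynomial_eval_le_eval q h1
      have h4 : E.m * E.n * min k E.n ≤ bitLength (E.encode k) ^ 3 := by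
        rw [pow_succ, sq]
        exact Nat.mul_le_mul (Nat.mul_le_mul h1 h2) ((min_le_right _ _).trans h2)
      have h5 : (70 * .X ^ 3 + q : Polynomial ℕ).eval (bitLength (E.encode k)) =
          70 * bitLength (E.encode k) ^ 3 + q.eval (bitLength (E.encode k)) := by simp
      omega
    · have := mul_min_le (m := E.m) (k := k) E.n_pos
      omega
  -- Here 87 = 70 + 5 + 12: the core, the copying loop per value, and the constant overhead, the
  -- last two absorbed by 1 ≤ m ≤ m n² k.
  · refine ⟨.seq (.seq .readParams .copyDissat) (.core ℓ), 87, fun E α k hE hα hk => ?_⟩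
    obtain ⟨t, ht, hout⟩ := exists_outputs_encodeWith ℓ E α hk
    refine ⟨_, t, hE.isOptimalCC_solution hα ℓ hk, hout, ?_⟩
    have h1 := mul_min_le (m := E.m) (k := k) E.n_pos
    have h2 : E.m ≤ E.m * E.n ^ 2 * k := by
      rw [mul_assoc]
      exact Nat.le_mul_of_pos_right _ (Nat.mul_pos (Nat.pow_pos E.n_pos) hk)
    have h3 := E.m_pos
    omega
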